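/- Let $n\ge 2$, let $V$ be a complex vector space, and let $X_1,\dots,X_n,Y_1,\dots,Y_n$ be symplectic bosons on $V$, that is, fields $A(z)=\sum_{m\in\mathbb Z}A_{(m)}z^{-m-1}$ with $A_{(m)}\in\operatorname{End}V$ and, for each $v\in V$, $A_{(m)}v=0$ for large $m$, satisfying $X_i(z)Y_j(w)\sim\frac{\delta_{ij}}{z-w}$, $X_i(z)X_j(w)\sim 0$, $Y_i(z)Y_j(w)\sim 0$. For fields $A,B$ and $p\in\mathbb Z$ put $$(AB)_p(w)=\oint_w\frac{dz}{2\pi i}(z-w)^{p-1}A(z)B(w)=\operatorname{Res}_{z}\Big(i_{|z|>|w|}(z-w)^{p-1}A(z)B(w)-i_{|w|>|z|}(z-w)^{p-1}B(w)A(z)\Big),$$ so that $(AB)_0$ is the normally ordered product, and write $A(z)B(w)\sim\sum_{p=1}^{N}\frac{C_p(w)}{(z-w)^p}$ if $[A(z),B(w)]=\sum_{p=1}^{N}C_p(w)\,\frac{1}{(p-1)!}\partial_w^{p-1}\delta(z-w)$. Put $\mathcal A_i=-(X_iY_i)_0$, let $D_i$ be the linear operator on fields $$D_i\mathcal O=2(\mathcal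 A_i\mathcal O)_0+(X_i(Y_i\mathcal O)_0)_0,$$ i.e. $D_i=\mathcal D_i+\hat{\mathcal A}_i$ with $\hat{\mathcal A}_i\mathcal O=(\mathcal A_i\mathcal O)_0$ and $\mathcal D_i\mathcal O=(\mathcal A_i\mathcal O)_0+(X_i(Y_i\mathcal O)_0)_0$, and set $\mathcal X=(X_1(X_2(\cdots X_n)_0)_0)_0$ and $\mathcal X_I=\prod_{i\in I}D_i\,\mathcal X$ for $I\subset\{1,\dots,n\}$. Let $I,J\subset\{1,\dots,n\}$ and put $K=I\cap J$, $L=I\setminus K$, $M=J\setminus K$. For a finite set $L$ let $L_a$ be the set of all subsets of $L$ obtained by removing exactly $a$ elements, and for $p\ge1$ let $\mathcal J_{LM,p}=\{(a,b)\in\mathbb Z^2: 0\le a\le|L|,\ 0\le b\le|M|,\ p\le a+b\}$. (1) If $I\ne J$, then for $1\le p\le|L|+|M|$ $$(\mathcal X_I\mathcal X_J)_p=\sum_{(a,b)\in\mathcal J_{LM,p}}\ \sum_{L'\in L_a}\ \sum_{M'\in M_b}(-1)^{a-p}\binom{a+b-1}{p-1}\,\big(\mathcal X_{K\cup L'}\,\mathcal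 X_{K\cup M'}\big)_{p-a-b},$$ and $(\mathcal X_I\mathcal X_J)_p=0$ for $p\ge|L|+|M|+1$. Moreover $$\mathcal X_I(z)\mathcal X_J(w)\sim\sum_{p=1}^{|L|+|M|}\frac1{(z-w)^p}\sum_{(a,b)\in\mathcal J_{LM,p}}\ \sum_{L'\in L_a}\ \sum_{M'\in M_b}\frac{(-1)^{a-p}}{(a+b-p)!}\binom{a+b-1}{p-1}\Big(\big(\partial^{a+b-p}\mathcal X_{K\cup L'}\big)\,\mathcal X_{K\cup M'}\Big)_0(w).$$ (2) If $I=J$, then $(\mathcal X_I\mathcal X_I)_p=0$ for all $p\ge1$, and $\mathcal X_I(z)\mathcal X_I(w)\sim0$. -/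

import Mathlib

open scoped VertexOperator

noncomputable section

namespace ChiralField

variable {V : Type*} [AddCommGroup V] [Module ℂ V]

/-! ### Fields on a complex vector space

A field `A(z) = ∑ₘ A₍ₘ₎ z^(-m-1)` on `V` is Mathlib's `VertexOperator ℂ V`; its mode `A₍ₘ₎` is
`A[[m]]`. Since `A(z) v` is a Laurent series, `A₍ₘ₎ v = 0` for all large `m`. -/

/-- For every vector `v`, the modes of a field annihilate `v` from some index on. -/
theorem exists_ncoeff_eq_zero (A : VertexOperator ℂ V) (v : V) :
    ∃ N : ℤ, ∀ m : ℤ, N ≤ m → (A[[m]]) v = 0 := by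
  refine ⟨-((HahnModule.of ℂ).symm (A v)).order, fun m hm => ?_⟩
  exact VertexOperator.ncoeff_eq_zero_of_lt_order A m v (by omega)

/-- A field given by its modes. -/
def ofModes (f : ℤ → Module.End ℂ V) (hf : ∀ v, ∃ N : ℤ, ∀ m : ℤ, N ≤ m → f m v = 0) :
    VertexOperator ℂ V :=
  VertexOperator.of_coeff (fun k => f (-k - 1)) fun v => by
    obtain ⟨N, hN⟩ := hf v
    refine ⟨-N, fun k hk => ?_⟩
    by_contra h
    exact hk (hN _ (by omega))

@[simp]
theorem ncoeff_ofModes (f : ℤ → Module.End ℂ V)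
    (hf : ∀ v, ∃ N : ℤ, ∀ m : ℤ, N ≤ m → f m v = 0) (m : ℤ) : (ofModes f hf)[[m]] = f m := by
  rw [ofModes, VertexOperator.ncoeff_of_coeff]
  congr 1
  ring

/-- The identity field `1(z) = id`. -/
def one (V : Type*) [AddCommGroup V] [Module ℂ V] : VertexOperator ℂ V :=
  ofModes (fun m => if m = -1 then 1 else 0) fun _ => ⟨0, fun m hm => by
    rw [if_neg (by omega), LinearMap.zero_apply]⟩

/-- The derivative `∂A(z) = ∑ₘ (-m) A₍ₘ₋₁₎ z^(-m-1)`. -/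
def der (A : VertexOperator ℂ V) : VertexOperator ℂ V :=
  ofModes (fun m => (-(m : ℂ)) • A[[m - 1]]) fun v => by
    obtain ⟨N, hN⟩ := exists_ncoeff_eq_zero A v
    exact ⟨N + 1, fun m hm => by
      rw [LinearMap.smul_apply, hN (m - 1) (by omega), smul_zero]⟩

/-- The `j`-th term of the mode `k` of the residue product `A₍ᵣ₎B`, see `resProd`. -/
def resTerm (A B : VertexOperator ℂ V) (r k : ℤ) (j : ℕ) : Module.End ℂ V :=
  ((-1 : ℂ) ^ j * (Ring.choose r j : ℤ)) •
    (A[[r - j]] * B[[k + j]] - ((-1 : ℂ) ^ r) • (B[[r + k - j]] * A[[(j : ℤ)]]))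

theorem resTerm_eq_zero (A B : VertexOperator ℂ V) (r k : ℤ) (j : ℕ) (v : V)
    (hB : (B[[k + j]]) v = 0) (hA : (B[[r + k - j]]) ((A[[(j : ℤ)]]) v) = 0) :
    resTerm A B r k j v = 0 := by
  simp only [resTerm, LinearMap.smul_apply, LinearMap.sub_apply, Module.End.mul_apply, hA, hB,
    map_zero, smul_zero, sub_zero]

theorem resTerm_support_finite (A B : VertexOperator ℂ V) (r k : ℤ) (v : V) :
    (Function.support fun j : ℕ => resTerm A B r k j v).Finite := by
  obtain ⟨M, hM⟩ := exists_ncoeff_eq_zero A v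
  obtain ⟨N, hN⟩ := exists_ncoeff_eq_zero B v
  refine (Set.finite_lt_nat (max M (N - k)).toNat).subset fun j hj => ?_
  by_contra h
  rw [Set.mem_ofPred_eq, not_lt] at h
  refine hj (resTerm_eq_zero A B r k j v (hN _ (by omega)) ?_)
  rw [hM _ (by omega), map_zero]

theorem resTerm_eventually_zero (A B : VertexOperator ℂ V) (r : ℤ) (v : V) :
    ∃ N : ℤ, ∀ k : ℤ, N ≤ k → ∀ j : ℕ, resTerm A B r k j v = 0 := by
  obtain ⟨M, hM⟩ := exists_ncoeff_eq_zero A v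
  obtain ⟨N, hN⟩ := exists_ncoeff_eq_zero B v
  choose f hf using fun j : ℕ => exists_ncoeff_eq_zero B ((A[[(j : ℤ)]]) v)
  obtain ⟨F, hF⟩ := ((Finset.range M.toNat).image fun j : ℕ => f j - r + j).bddAbove
  refine ⟨max N F, fun k hk j => resTerm_eq_zero A B r k j v (hN _ (by omega)) ?_⟩
  by_cases hj : M ≤ j
  · rw [hM _ hj, map_zero]
  · have h : f j - r + j ≤ F :=
      hF (Finset.mem_coe.2 (Finset.mem_image_of_mem _ (Finset.mem_range.2 (by omega))))
    exact hf j _ (by omega)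

/-- The mode `k` of the residue product `A₍ᵣ₎B`; on each vector the sum over `j` is finite. -/
def resMode (A B : VertexOperator ℂ V) (r k : ℤ) : Module.End ℂ V where
  toFun v := ∑ᶠ j : ℕ, resTerm A B r k j v
  map_add' u v := by
    simp only [map_add]
    exact finsum_add_distrib (resTerm_support_finite A B r k u) (resTerm_support_finite A B r k v)
  map_smul' c v := by
    simp only [map_smul, RingHom.id_apply]
    exact (smul_finsum' c (resTerm_support_finite A B r k v)).symm

/-- The residue product
`(A₍ᵣ₎B)(w) = Res_z ( A(z) B(w) i_{|z|>|w|} (z-w)^r - B(w) A(z) i_{|w|>|z|} (z-w)^r )`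
of two fields, for any integer `r`. Its mode `k` is
`∑_{j ≥ 0} (-1)^j (r choose j) (A₍ᵣ₋ⱼ₎ B₍ₖ₊ⱼ₎ - (-1)^r B₍ᵣ₊ₖ₋ⱼ₎ A₍ⱼ₎)`. -/
def resProd (A B : VertexOperator ℂ V) (r : ℤ) : VertexOperator ℂ V :=
  ofModes (resMode A B r) fun v => by
    obtain ⟨N, hN⟩ := resTerm_eventually_zero A B r v
    refine ⟨N, fun k hk => ?_⟩
    change ∑ᶠ j : ℕ, resTerm A B r k j v = 0
    simp only [hN k hk, finsum_zero]

/-- The product `(AB)_p(w) = ∮ dz/(2πi) (z-w)^(p-1) A(z) B(w)`, where the contour encircles `w` and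
`A(z) B(w)` is radially ordered. It is the coefficient of `(z-w)^(-p)` in the operator product
expansion of `A(z) B(w)`; the case `p = 0` is the normally ordered product. -/
def prod (p : ℤ) (A B : VertexOperator ℂ V) : VertexOperator ℂ V :=
  resProd A B (p - 1)

/-- The operator product expansion `A(z) B(w) ∼ ∑_{p=1}^N C_p(w) / (z-w)^p`, in the form
`[A(z), B(w)] = ∑_{p=1}^N C_p(w) ∂_w^(p-1) δ(z-w) / (p-1)!`. In modes this reads
`[A₍ₘ₎, B₍ₖ₎] = ∑_{p=1}^N (m choose p-1) (C_p)₍ₘ₊ₖ₋₍ₚ₋₁₎₎`. -/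
def OPE (A B : VertexOperator ℂ V) (N : ℕ) (C : ℕ → VertexOperator ℂ V) : Prop :=
  ∀ m k : ℤ, A[[m]] * B[[k]] - B[[k]] * A[[m]] =
    ∑ p ∈ Finset.Icc 1 N,
      ((Ring.choose m (p - 1) : ℤ) : ℂ) • (C p)[[m + k - ((p : ℤ) - 1)]]

/-! ### Symplectic bosons -/

/-- A system of `n` symplectic bosons on `V`: fields `X_i`, `Y_i` with
`X_i(z) Y_j(w) ∼ δ_ij / (z-w)` and `X_i(z) X_j(w) ∼ 0`, `Y_i(z) Y_j(w) ∼ 0`. -/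
structure SymplecticBosons (n : ℕ) (V : Type*) [AddCommGroup V] [Module ℂ V] where
  X : Fin n → VertexOperator ℂ V
  Y : Fin n → VertexOperator ℂ V
  ope_XY : ∀ i j, OPE (X i) (Y j) 1 fun _ => if i = j then one V else 0
  ope_XX : ∀ i j, OPE (X i) (X j) 0 fun _ => 0
  ope_YY : ∀ i j, OPE (Y i) (Y j) 0 fun _ => 0

namespace SymplecticBosons

variable {n : ℕ} (S : SymplecticBosons n V)

/-- `𝒜_i = -(X_i Y_i)_0`. -/
def curA (i : Fin n) : VertexOperator ℂ V := -prod 0 (S.X i) (S.Y i)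

/-- The multiplication operator `𝒜̂_i 𝒪 = (𝒜_i 𝒪)_0`. -/
def hatA (i : Fin n) (O : VertexOperator ℂ V) : VertexOperator ℂ V := prod 0 (S.curA i) O

/-- The partial derivative `𝒟_i 𝒪 = (𝒜_i 𝒪)_0 + (X_i (Y_i 𝒪)_0)_0`. -/
def calD (i : Fin n) (O : VertexOperator ℂ V) : VertexOperator ℂ V :=
  prod 0 (S.curA i) O + prod 0 (S.X i) (prod 0 (S.Y i) O)

/-- The covariant derivative `D_i = 𝒟_i + 𝒜̂_i`. -/
def covD (i : Fin n) (O : VertexOperator ℂ V) : VertexOperator ℂ V := S.calD i O + S.hatA i O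

/-- `𝒳 = X_1 X_2 ⋯ X_n`, the nested normally ordered product `(X_1 (X_2 (⋯ X_n)_0)_0)_0`. The
innermost factor is multiplied by the identity field, which does not change it. -/
def calX : VertexOperator ℂ V := (List.ofFn S.X).foldr (prod 0) (one V)

/-- `𝒳_I = ∏_{i ∈ I} D_i 𝒳`. The operators `D_i` commute; they are applied in a fixed order. -/
def calXI (I : Finset (Fin n)) : VertexOperator ℂ V := I.sort.foldr S.covD S.calX

end SymplecticBosons

/-! ### Index sets -/

/-- The subsets of `L` that arise by removing exactly `a` elements. -/
def removing {n : ℕ} (L : Finset (Fin n)) (a : ℕ) : Finset (Finset (Fin n)) :=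
  L.powerset.filter fun S => (L \ S).card = a

/-- The pairs `(a, b)` with `0 ≤ a ≤ |L|`, `0 ≤ b ≤ |M|` and `p ≤ a + b`. -/
def indexPairs {n : ℕ} (L M : Finset (Fin n)) (p : ℕ) : Finset (ℕ × ℕ) :=
  (Finset.range (L.card + 1) ×ˢ Finset.range (M.card + 1)).filter fun ab => p ≤ ab.1 + ab.2

/-! ### The Fock space: symplectic bosons exist -/

/-- The Fock space of `n` symplectic bosons: polynomials in the creation operators `x_{i,k}`
(`Sum.inl (i, k)`) and `y_{i,k}` (`Sum.inr (i, k)`), `k ≥ 0`. -/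
abbrev Fock (n : ℕ) : Type := MvPolynomial ((Fin n × ℕ) ⊕ (Fin n × ℕ)) ℂ

/-- The modes of a free field on a polynomial ring: the mode `-k-1` with `k ≥ 0` is multiplication
by the variable `u k`, the mode `k ≥ 0` is `c ∂/∂(v k)`. -/
def fockMode {σ : Type} (u v : ℕ → σ) (c : ℂ) (m : ℤ) : Module.End ℂ (MvPolynomial σ ℂ) :=
  if 0 ≤ m then c • (MvPolynomial.pderiv (R := ℂ) (v m.toNat)).toLinearMap
  else LinearMap.mulLeft ℂ (MvPolynomial.X (u (-m - 1).toNat))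

theorem fockMode_eventually_zero {σ : Type} (u v : ℕ → σ) (hv : Function.Injective v) (c : ℂ)
    (f : MvPolynomial σ ℂ) : ∃ N : ℤ, ∀ m : ℤ, N ≤ m → fockMode u v c m f = 0 := by
  classical
  obtain ⟨B, hB⟩ := (f.vars.preimage v hv.injOn).bddAbove
  refine ⟨(B : ℤ) + 1, fun m hm => ?_⟩
  rw [fockMode, if_pos (by omega), LinearMap.smul_apply]
  have h : v m.toNat ∉ f.vars := fun h => by
    have := hB (Finset.mem_coe.2 (Finset.mem_preimage.2 h))
    omega
  rw [Derivation.coeFn_coe, MvPolynomial.pderiv_eq_zero_of_notMem_vars h, smul_zero]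

theorem fockMode_comm {σ : Type} [DecidableEq σ] (u v u' v' : ℕ → σ) (c c' : ℂ) (m k : ℤ) :
    fockMode u v c m * fockMode u' v' c' k - fockMode u' v' c' k * fockMode u v c m =
      if 0 ≤ m ∧ k < 0 ∧ u' (-k - 1).toNat = v m.toNat then c • 1
      else if m < 0 ∧ 0 ≤ k ∧ u (-m - 1).toNat = v' k.toNat then -c' • 1 else 0 := by
  have hpd : ∀ (a b : σ) (f : MvPolynomial σ ℂ),
      MvPolynomial.pderiv a (MvPolynomial.pderiv b f) =
        MvPolynomial.pderiv b (MvPolynomial.pderiv a f) := fun a b f => by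
    have h : ⁅MvPolynomial.pderiv (R := ℂ) a, MvPolynomial.pderiv (R := ℂ) b⁆ = 0 := by
      refine MvPolynomial.derivation_ext fun i => ?_
      have hc : ∀ x y : σ, MvPolynomial.pderiv x
          (Pi.single (M := fun _ => MvPolynomial σ ℂ) y 1 i) = 0 := fun x y => by
        by_cases h : i = y
        · subst h
          rw [Pi.single_eq_same, Derivation.map_one_eq_zero]
        · rw [Pi.single_eq_of_ne h, map_zero]
      rw [Derivation.commutator_apply, MvPolynomial.pderiv_X, MvPolynomial.pderiv_X, hc, hc,
        sub_self, Derivation.zero_apply]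
    have h2 := DFunLike.congr_fun h f
    rw [Derivation.commutator_apply, Derivation.zero_apply] at h2
    exact sub_eq_zero.1 h2
  have hpos : ∀ (u v : ℕ → σ) (c : ℂ) (m : ℤ), 0 ≤ m → ∀ f,
      fockMode u v c m f = c • MvPolynomial.pderiv (v m.toNat) f := fun u v c m hm f => by
    rw [fockMode, if_pos hm]
    rfl
  have hneg : ∀ (u v : ℕ → σ) (c : ℂ) (m : ℤ), m < 0 → ∀ f,
      fockMode u v c m f = MvPolynomial.X (u (-m - 1).toNat) * f := fun u v c m hm f => by
    rw [fockMode, if_neg (not_le.2 hm)]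
    rfl
  have hX : ∀ (a b : σ) (f : MvPolynomial σ ℂ),
      MvPolynomial.pderiv a (MvPolynomial.X b * f) =
        MvPolynomial.X b * MvPolynomial.pderiv a f + if b = a then f else 0 := fun a b f => by
    rw [Derivation.leibniz, MvPolynomial.pderiv_X, smul_eq_mul, smul_eq_mul]
    by_cases h : b = a
    · rw [h, Pi.single_eq_same, if_pos rfl, mul_one]
    · rw [Pi.single_eq_of_ne h, if_neg h, mul_zero]
  refine LinearMap.ext fun f => ?_
  rw [LinearMap.sub_apply, Module.End.mul_apply, Module.End.mul_apply]
  rcases lt_or_ge m 0 with hm | hm <;> rcases lt_or_ge k 0 with hk | hk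
  · rw [if_neg (by omega), if_neg (by omega), hneg _ _ _ _ hm, hneg _ _ _ _ hk,
      hneg _ _ _ _ hk, hneg _ _ _ _ hm, mul_left_comm, sub_self, LinearMap.zero_apply]
  · rw [if_neg (by omega), hneg _ _ _ _ hm, hpos _ _ _ _ hk, hpos _ _ _ _ hk, hneg _ _ _ _ hm,
      hX, smul_add, mul_smul_comm, sub_add_cancel_left]
    by_cases h : u (-m - 1).toNat = v' k.toNat
    · rw [if_pos h, if_pos ⟨hm, hk, h⟩, LinearMap.smul_apply, Module.End.one_apply, neg_smul]
    · rw [if_neg h, if_neg (fun h' => h h'.2.2), smul_zero, neg_zero, LinearMap.zero_apply]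
  · rw [hneg _ _ _ _ hk, hpos _ _ _ _ hm, hpos _ _ _ _ hm, hneg _ _ _ _ hk, hX, smul_add,
      mul_smul_comm, add_sub_cancel_left]
    by_cases h : u' (-k - 1).toNat = v m.toNat
    · rw [if_pos h, if_pos ⟨hm, hk, h⟩, LinearMap.smul_apply, Module.End.one_apply]
    · rw [if_neg h, if_neg (fun h' => h h'.2.2), if_neg (by omega), smul_zero,
        LinearMap.zero_apply]
  · rw [if_neg (by omega), if_neg (by omega), hpos _ _ _ _ hm, hpos _ _ _ _ hk, hpos _ _ _ _ hk,
      hpos _ _ _ _ hm, Derivation.map_smul, Derivation.map_smul, hpd, smul_comm, sub_self, LinearMap.zero_apply]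

/-- The symplectic bosons on the Fock space: `X_i` has the creation operators `x_{i,k}` and the
annihilation operators `∂/∂y_{i,k}`, and `Y_i` has the creation operators `y_{i,k}` and the
annihilation operators `-∂/∂x_{i,k}`. -/
def SymplecticBosons.fock (n : ℕ) : SymplecticBosons n (Fock n) where
  X i := ofModes (fockMode (fun k => .inl (i, k)) (fun k => .inr (i, k)) 1)
    (fockMode_eventually_zero _ _ (fun a b h => by simpa using h) 1)
  Y i := ofModes (fockMode (fun k => .inr (i, k)) (fun k => .inl (i, k)) (-1))
    (fockMode_eventually_zero _ _ (fun a b h => by simpa using h) (-1))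
  ope_XY i j m k := by
    simp only [ncoeff_ofModes, fockMode_comm, Sum.inr.injEq, Sum.inl.injEq, Prod.mk.injEq,
      Finset.Icc_self, Finset.sum_singleton, Nat.sub_self, Ring.choose_zero_right, Int.cast_one,
      one_smul, neg_neg, Nat.cast_one, sub_self, sub_zero]
    by_cases hij : i = j
    · subst hij
      simp only [true_and, if_true, one, ncoeff_ofModes]
      split_ifs <;> first | rfl | omega
    · simp only [hij, Ne.symm hij, false_and, and_false, if_false, map_zero, Pi.zero_apply]
  ope_XX i j m k := by
    simp [fockMode_comm]
  ope_YY i j m k := by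
    simp [fockMode_comm]

end ChiralField

end

/-! Bosons with different indices commute, so `𝒳_I` is a true product of commuting fields, one for
each `i`: the factor is `X_i` if `i ∉ I`, and `D_i X_i` if `i ∈ I` (`calXI_eq`). Hence `𝒳_I(z)
𝒳_J(w)` is a product over `i` of two-variable factors (`comp_calXI`), and the operator product
problem reduces to one boson pair. There `DX = -(Y X²)_0 + 2∂X` (`bosonD_eq`), and a direct
computation gives `DX(z) X(w) ∼ X(w)²/(z-w)` and `DX(z) DX(w) ∼ 0`. So only indices in the symmetric
difference `D` of `I` and `J` have a contraction, with sign `ε_i = 1` on `I \ J` and `ε_i = -1` on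
`J \ I`.

The decisive choice is to write the singular part as `ε_i X_i(z) X_i(w)/(z-w)`, with a bilocal
numerator. The remainder is still regular (`isRegular_reg`), and contracting the factors in `T`
gives exactly `(z-w)^(-|T|) 𝒳_{I \ T}(z) 𝒳_{J \ T}(w)` up to sign (`comp_calXI_sdiff`).

Let `H r T S` be the residue against `(z-w)^r` of the product in which the factors in `T` are
contracted and those in `S` are replaced by their regular remainders. Then `H r T S = ε_i H (r-1) (T
∪ {i}) S + H r T (S ∪ {i})`, and `H r T S = 0` for `r ≥ 0` once `T ∪ S` contains `D`. The remainders
must be eliminated, since they are not products of two fields. Expanding every slot and inverting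
gives `H (p-1) ∅ ∅ = ∑_T c_|T| ε_T H (p-1-|T|) T ∅` with `ε_T = ∏_{i ∈ T} ε_i`
(`resolution_formula`), for any `c` with `∑_k (m choose k) c_k = 1` for all `m ≥ p` and `c_k = 0`
for `k < p`. These force `c_k = (-1)^(k-p) (k-1 choose p-1)` for `k ≥ p`. Sorting the sets `T` by
their sizes `a`, `b` inside `L` and `M` gives the stated formula.

For the operator product expansion, `(z-w)^|D|` kills the commutator (`local_listMul_mixed`), and a
distribution killed by such a power is determined by its residues
(`eq_sum_of_diffOp_iterate_eq_zero`). The products of nonpositive order become normally ordered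
products of derivatives by `prod_zero_der_iterate`. -/

noncomputable section

namespace ChiralField

open HVertexOperator

variable {V : Type*} [AddCommGroup V] [Module ℂ V]

/-! ### Commuting operator-valued series and their products -/

section Commuting

variable {Γ Γ' : Type*} [PartialOrder Γ] [PartialOrder Γ']

/-- Two vertex operators all of whose coefficients commute. -/
def Comm (A : HVertexOperator Γ ℂ V V) (B : HVertexOperator Γ' ℂ V V) : Prop :=
  ∀ a b v, A.coeff a (B.coeff b v) = B.coeff b (A.coeff a v)

theorem Comm.symm {A : HVertexOperator Γ ℂ V V} {B : HVertexOperator Γ' ℂ V V} (h : Comm A B) :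
    Comm B A := fun a b v => (h b a v).symm

theorem Comm.add_right {A : HVertexOperator Γ ℂ V V} {B C : HVertexOperator Γ' ℂ V V}
    (hB : Comm A B) (hC : Comm A C) : Comm A (B + C) := fun a b v => by
  simp only [map_add, Pi.add_apply, LinearMap.add_apply, hB a b v, hC a b v]

theorem Comm.smul_right {A : HVertexOperator Γ ℂ V V} {B : HVertexOperator Γ' ℂ V V}
    (hB : Comm A B) (c : ℂ) : Comm A (c • B) := fun a b v => by
  simp only [map_smul, Pi.smul_apply, LinearMap.smul_apply, hB a b v]

theorem Comm.neg_right {A : HVertexOperator Γ ℂ V V} {B : HVertexOperator Γ' ℂ V V}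
    (hB : Comm A B) : Comm A (-B) := fun a b v => by
  simp only [map_neg, Pi.neg_apply, LinearMap.neg_apply, hB a b v]

theorem Comm.sub_right {A : HVertexOperator Γ ℂ V V} {B C : HVertexOperator Γ' ℂ V V}
    (hB : Comm A B) (hC : Comm A C) : Comm A (B - C) := fun a b v => by
  simp only [map_sub, Pi.sub_apply, LinearMap.sub_apply, hB a b v, hC a b v]

theorem hv_ext {A B : HVertexOperator Γ ℂ V V} (h : ∀ a v, A.coeff a v = B.coeff a v) : A = B :=
  coeff_inj (funext fun a => LinearMap.ext (h a))

end Commuting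

section Mul

variable {Γ Γ' : Type*} [AddCommGroup Γ] [PartialOrder Γ] [IsOrderedCancelAddMonoid Γ]
  [PartialOrder Γ']

theorem coeff_support_isPWO (A : HVertexOperator Γ' ℂ V V) (v : V) :
    {a | A.coeff a v ≠ 0}.IsPWO :=
  A.coeff_isPWOsupport v

/-- Since `A` and `B` commute, a nonzero term needs both `A_a v ≠ 0` and `B_{m-a} v ≠ 0`. Two
partially well-ordered sets of exponents have only finitely many pairs with a given sum. -/
theorem mul_support_finite {A B : HVertexOperator Γ ℂ V V} (h : Comm A B) (m : Γ) (v : V) :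
    (Function.support fun a => A.coeff a (B.coeff (m - a) v)).Finite := by
  refine ((Set.AddAntidiagonal.finite_of_isPWO (coeff_support_isPWO A v)
    (coeff_support_isPWO B v) m).image Prod.fst).subset fun a ha => ?_
  refine ⟨(a, m - a), ?_, rfl⟩
  rw [Set.mem_antidiagonal]
  refine ⟨fun h0 => ha ?_, fun h0 => ha ?_, add_sub_cancel a m⟩
  · change A.coeff a v = 0 at h0
    change A.coeff a (B.coeff (m - a) v) = 0
    rw [h, h0, map_zero]
  · change B.coeff (m - a) v = 0 at h0
    change A.coeff a (B.coeff (m - a) v) = 0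
    rw [h0, map_zero]

open Classical in
/-- The product `A(z) B(z)` of two commuting vertex operators (and `0` if they do not commute). -/
def mul (A B : HVertexOperator Γ ℂ V V) : HVertexOperator Γ ℂ V V :=
  if h : Comm A B then
    of_coeff (fun m =>
      { toFun := fun v => ∑ᶠ a, A.coeff a (B.coeff (m - a) v)
        map_add' := fun u v => by
          simp only [map_add]
          exact finsum_add_distrib (mul_support_finite h m u) (mul_support_finite h m v)
        map_smul' := fun c v => by
          simp only [map_smul, RingHom.id_apply]
          exact (smul_finsum' c (mul_support_finite h m v)).symm }) fun v => by
      refine ((coeff_support_isPWO A v).add (coeff_support_isPWO B v)).mono fun m hm => ?_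
      obtain ⟨a, ha⟩ : ∃ a, A.coeff a (B.coeff (m - a) v) ≠ 0 := by
        by_contra! h0
        exact hm ((finsum_congr h0).trans finsum_zero)
      refine ⟨a, fun h0 => ha ?_, m - a, fun h0 => ha ?_, add_sub_cancel a m⟩
      · change A.coeff a v = 0 at h0
        rw [h, h0, map_zero]
      · change B.coeff (m - a) v = 0 at h0
        rw [h0, map_zero]
  else 0

theorem coeff_mul {A B : HVertexOperator Γ ℂ V V} (h : Comm A B) (m : Γ) (v : V) :
    (mul A B).coeff m v = ∑ᶠ a, A.coeff a (B.coeff (m - a) v) := by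
  rw [mul, dif_pos h]
  rfl

theorem mul_comm_of_comm {A B : HVertexOperator Γ ℂ V V} (h : Comm A B) : mul A B = mul B A := by
  refine hv_ext fun m v => ?_
  rw [coeff_mul h, coeff_mul h.symm, ← finsum_comp_equiv (Equiv.subLeft m)]
  refine finsum_congr fun a => ?_
  rw [Equiv.subLeft_apply, sub_sub_cancel, h]

theorem Comm.mul_right {A : HVertexOperator Γ' ℂ V V} {B C : HVertexOperator Γ ℂ V V}
    (hBC : Comm B C) (hB : Comm A B) (hC : Comm A C) : Comm A (mul B C) := fun a m v => by
  rw [coeff_mul hBC, coeff_mul hBC, map_finsum _ (mul_support_finite hBC m v)]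
  exact finsum_congr fun b => by rw [hB, hC]

theorem mul_add_right {A B C : HVertexOperator Γ ℂ V V} (hB : Comm A B) (hC : Comm A C) :
    mul A (B + C) = mul A B + mul A C := by
  refine hv_ext fun m v => ?_
  rw [map_add, Pi.add_apply, LinearMap.add_apply, coeff_mul hB, coeff_mul hC,
    coeff_mul (hB.add_right hC),
    ← finsum_add_distrib (mul_support_finite hB m v) (mul_support_finite hC m v)]
  exact finsum_congr fun a => by
    simp only [map_add, Pi.add_apply, LinearMap.add_apply]

theorem mul_smul_right {A B : HVertexOperator Γ ℂ V V} (hB : Comm A B) (c : ℂ) :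
    mul A (c • B) = c • mul A B := by
  refine hv_ext fun m v => ?_
  rw [map_smul, Pi.smul_apply, LinearMap.smul_apply, coeff_mul hB, coeff_mul (hB.smul_right c),
    smul_finsum' c (mul_support_finite hB m v)]
  exact finsum_congr fun a => by
    simp only [map_smul, Pi.smul_apply, LinearMap.smul_apply]

theorem mul_add_left {A B C : HVertexOperator Γ ℂ V V} (hB : Comm B A) (hC : Comm C A) :
    mul (B + C) A = mul B A + mul C A := by
  rw [mul_comm_of_comm (hB.symm.add_right hC.symm).symm, mul_add_right hB.symm hC.symm,
    mul_comm_of_comm hB, mul_comm_of_comm hC]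

theorem mul_smul_left {A B : HVertexOperator Γ ℂ V V} (hB : Comm B A) (c : ℂ) :
    mul (c • B) A = c • mul B A := by
  rw [mul_comm_of_comm (hB.symm.smul_right c).symm, mul_smul_right hB.symm, mul_comm_of_comm hB]

/-- Multiplication by the monomial with exponent `g`. -/
def shift (g : Γ) (A : HVertexOperator Γ ℂ V V) : HVertexOperator Γ ℂ V V :=
  of_coeff (fun a => A.coeff (a - g)) fun v => by
    refine ((Set.isPWO_singleton g).add (coeff_support_isPWO A v)).mono fun a ha => ?_
    exact ⟨g, rfl, a - g, ha, add_sub_cancel g a⟩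

theorem coeff_shift (g : Γ) (A : HVertexOperator Γ ℂ V V) (a : Γ) :
    (shift g A).coeff a = A.coeff (a - g) := rfl

theorem Comm.shift_right {A : HVertexOperator Γ' ℂ V V} {B : HVertexOperator Γ ℂ V V}
    (h : Comm A B) (g : Γ) : Comm A (shift g B) := fun a b v => by
  rw [coeff_shift, h]

theorem mul_shift_right {A B : HVertexOperator Γ ℂ V V} (h : Comm A B) (g : Γ) :
    mul A (shift g B) = shift g (mul A B) := by
  refine hv_ext fun m v => ?_
  rw [coeff_shift, coeff_mul h, coeff_mul (h.shift_right g)]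
  exact finsum_congr fun a => by rw [coeff_shift, sub_right_comm]

theorem mul_shift_left {A B : HVertexOperator Γ ℂ V V} (h : Comm B A) (g : Γ) :
    mul (shift g B) A = shift g (mul B A) := by
  rw [mul_comm_of_comm (h.symm.shift_right g).symm, mul_shift_right h.symm, mul_comm_of_comm h]

end Mul

theorem coeff_comp_apply {Γ Γ' : Type*} [PartialOrder Γ] [PartialOrder Γ']
    (A : HVertexOperator Γ ℂ V V) (B : HVertexOperator Γ' ℂ V V) (g : Γ' ×ₗ Γ) (v : V) :
    (comp A B).coeff g v = A.coeff (ofLex g).2 (B.coeff (ofLex g).1 v) := rfl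

theorem Comm.comp_right {Γ Γ' Γ'' : Type*} [PartialOrder Γ] [PartialOrder Γ'] [PartialOrder Γ'']
    {A : HVertexOperator Γ'' ℂ V V} {B : HVertexOperator Γ ℂ V V}
    {C : HVertexOperator Γ' ℂ V V} (hB : Comm A B) (hC : Comm A C) : Comm A (comp B C) :=
  fun a g v => by rw [coeff_comp_apply, coeff_comp_apply, hB, hC]

/-! ### Products of series in two variables -/

section Comp

variable {Γ Γ' : Type*} [AddCommGroup Γ] [PartialOrder Γ] [IsOrderedCancelAddMonoid Γ]
  [AddCommGroup Γ'] [PartialOrder Γ'] [IsOrderedCancelAddMonoid Γ']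

/-- Only `B(z)` and `E'(w)` have to change places. This regrouping splits the product of two
composite fields into two-variable factors that can be treated one boson at a time. -/
theorem comp_mul {E B : HVertexOperator Γ ℂ V V} {E' B' : HVertexOperator Γ' ℂ V V}
    (hEB : Comm E B) (hEB' : Comm E B') (hE'B : Comm E' B) (hE'B' : Comm E' B') :
    comp (mul E B) (mul E' B') = mul (comp E E') (comp B B') := by
  have hc : Comm (comp E E') (comp B B') :=
    ((hEB.comp_right hEB').symm.comp_right (hE'B.comp_right hE'B').symm).symm
  refine hv_ext fun g v => ?_
  rw [coeff_comp_apply, coeff_mul hE'B', map_finsum _ (mul_support_finite hE'B' _ v),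
    coeff_mul hc, ← finsum_comp_equiv toLex]
  have hfin := mul_support_finite hc g v
  rw [finsum_curry _ (hfin.preimage toLex.injective.injOn)]
  refine finsum_congr fun b => ?_
  rw [coeff_mul hEB]
  refine finsum_congr fun a => ?_
  rw [← hE'B]
  rfl

end Comp

/-! ### Finite sums -/

section Finsum

variable {W : Type*} [AddCommGroup W]

theorem support_finite_of_bound {f : ℕ → W} (N : ℕ) (h : ∀ j, N ≤ j → f j = 0) :
    (Function.support f).Finite :=
  (Set.finite_lt_nat N).subset fun j hj => by
    by_contra hlt
    exact hj (h j (not_lt.1 hlt))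

theorem finsum_nat_succ {f : ℕ → W} (hf : (Function.support f).Finite) :
    ∑ᶠ j, f j = f 0 + ∑ᶠ j, f (j + 1) := by
  obtain ⟨N, hN⟩ := hf.bddAbove
  have h1 : Function.support f ⊆ ↑(Finset.range (N + 1)) := fun j hj =>
    Finset.mem_coe.2 (Finset.mem_range.2 (Nat.lt_succ_of_le (hN hj)))
  have h2 : (Function.support fun j => f (j + 1)) ⊆ ↑(Finset.range N) := fun j hj =>
    Finset.mem_coe.2 (Finset.mem_range.2 (hN hj))
  rw [finsum_eq_sum_of_support_subset _ h1, finsum_eq_sum_of_support_subset _ h2,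
    Finset.sum_range_succ', add_comm]

/-- Used to compare a sum over all modes with the creation and annihilation halves of a normally
ordered product. -/
theorem finsum_int_split {f : ℤ → W} (hf : (Function.support f).Finite) (c : ℤ) :
    ∑ᶠ a, f a = ∑ᶠ j : ℕ, f (c + j) + ∑ᶠ j : ℕ, f (c - 1 - j) := by
  have i1 : Function.Injective fun j : ℕ => c + (j : ℤ) := fun a b h => by
    simpa using h
  have i2 : Function.Injective fun j : ℕ => c - 1 - (j : ℤ) := fun a b h => by
    simpa using h
  rw [← finsum_mem_range i1, ← finsum_mem_range i2,
    ← finsum_mem_union' _ (hf.subset Set.inter_subset_right) (hf.subset Set.inter_subset_right)]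
  · rw [← finsum_mem_univ]
    refine finsum_mem_congr (Set.ext fun a => ⟨fun _ => ?_, fun _ => trivial⟩) fun _ _ => rfl
    rcases le_or_gt c a with h | h
    · exact Or.inl ⟨(a - c).toNat, by dsimp only; omega⟩
    · exact Or.inr ⟨(c - 1 - a).toNat, by dsimp only; omega⟩
  · rw [Set.disjoint_left]
    rintro _ ⟨j, rfl⟩ ⟨i, hi⟩
    dsimp only at hi
    omega

/-- There are `l + 1` pairs `(i, j)` with `i + j = l`; these multiplicities later become the
coefficients of a derivative. -/
theorem finsum_finsum_add {f : ℕ → W} (hf : (Function.support f).Finite) :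
    ∑ᶠ i, ∑ᶠ j, f (i + j) = ∑ᶠ l, (l + 1) • f l := by
  obtain ⟨N, hN⟩ := hf.bddAbove
  have h0 : ∀ j, N < j → f j = 0 := fun j hj => by
    by_contra h
    exact absurd (hN h) (not_le.2 hj)
  have h1 : ∀ i, ∑ᶠ j, f (i + j) = ∑ l ∈ (Finset.range (N + 1)).filter (i ≤ ·), f l := fun i => by
    rw [finsum_eq_sum_of_support_subset (s := Finset.range (N + 1 - i))]
    · rw [← Finset.sum_image (f := f) (g := fun j => i + j) (fun a _ b _ h => by simpa using h)]
      refine Finset.sum_congr (Finset.ext fun l => ?_) fun _ _ => rfl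
      simp only [Finset.mem_image, Finset.mem_range, Finset.mem_filter]
      exact ⟨by rintro ⟨j, hj, rfl⟩; omega, fun h => ⟨l - i, by omega, by omega⟩⟩
    · intro j hj
      have := hN hj
      simp only [Finset.coe_range, Set.mem_Iio]
      omega
  simp only [h1]
  rw [finsum_eq_sum_of_support_subset (s := Finset.range (N + 1)),
    finsum_eq_sum_of_support_subset (s := Finset.range (N + 1))]
  · rw [Finset.sum_comm' (t' := Finset.range (N + 1)) (s' := fun l => Finset.range (l + 1))]
    · refine Finset.sum_congr rfl fun l _ => ?_
      rw [Finset.sum_const, Finset.card_range]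
    · intro i l
      simp only [Finset.mem_filter, Finset.mem_range]
      omega
  · intro l hl
    have : f l ≠ 0 := fun h => hl (by simp only [h, smul_zero])
    have := hN this
    simp only [Finset.coe_range, Set.mem_Iio]
    omega
  · intro i hi
    by_contra h
    simp only [Finset.coe_range, Set.mem_Iio] at h
    refine hi (Finset.sum_eq_zero fun l hl => ?_)
    simp only [Finset.mem_filter, Finset.mem_range] at hl
    omega

theorem finsum_comm_of_finite {α β : Type*} {f : α → β → W}
    (hf : (Function.support fun p : α × β => f p.1 p.2).Finite) :
    ∑ᶠ a, ∑ᶠ b, f a b = ∑ᶠ b, ∑ᶠ a, f a b := by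
  rw [← finsum_curry (fun p : α × β => f p.1 p.2) hf, ← finsum_comp_equiv (Equiv.prodComm β α),
    finsum_curry _ (hf.preimage (Equiv.prodComm β α).injective.injOn)]
  rfl

/-- The signed binomial coefficient `(-1)^j (r choose j)`. -/
def signedChoose (r : ℤ) (j : ℕ) : ℂ := (-1) ^ j * (Ring.choose r j : ℤ)

theorem signedChoose_zero (r : ℤ) : signedChoose r 0 = 1 := by
  simp [signedChoose]

theorem signedChoose_succ (r : ℤ) (j : ℕ) :
    signedChoose (r + 1) (j + 1) = signedChoose r (j + 1) - signedChoose r j := by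
  simp only [signedChoose, Ring.choose_succ_succ, Int.cast_add, pow_succ]
  ring

theorem signedChoose_neg_one (j : ℕ) : signedChoose (-1) j = 1 := by
  induction j with
  | zero => exact signedChoose_zero _
  | succ j ih =>
    have h := signedChoose_succ (-1) j
    rw [ih, neg_add_cancel] at h
    have h0 : signedChoose 0 (j + 1) = 0 := by
      rw [signedChoose, Ring.choose_zero_succ, Int.cast_zero, mul_zero]
    rw [h0] at h
    linear_combination -h

/-- Summation by parts with Pascal's rule: this is `(z-w)^r (z-w) = (z-w)^(r+1)` at the level of
coefficients. -/
theorem finsum_signedChoose [Module ℂ W] {g : ℕ → W} (hg : (Function.support g).Finite) (r : ℤ) :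
    ∑ᶠ j, signedChoose r j • (g j - g (j + 1)) = ∑ᶠ j, signedChoose (r + 1) j • g j := by
  have hs : ∀ c : ℕ → ℂ, (Function.support fun j => c j • g j).Finite := fun c =>
    hg.subset fun j hj h => hj (by simp only [h, smul_zero])
  have hg' : (Function.support fun j => g (j + 1)).Finite :=
    hg.preimage (f := fun j : ℕ => j + 1) (fun a _ b _ h => by simpa using h)
  have hs' : ∀ c : ℕ → ℂ, (Function.support fun j => c j • g (j + 1)).Finite := fun c =>
    hg'.subset fun j hj h => hj (by simp only [h, smul_zero])
  rw [finsum_nat_succ (hs _)]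
  simp only [smul_sub, signedChoose_succ, sub_smul]
  rw [finsum_sub_distrib (hs _) (hs' _), finsum_sub_distrib (hs' fun j => signedChoose r (j + 1))
    (hs' _), finsum_nat_succ (hs _), signedChoose_zero, signedChoose_zero, add_sub_assoc]

end Finsum

/-! ### Two-variable operators -/

/-- The mode `(p, q)` of an operator-valued series in two variables. -/
def mode2 (U : HVertexOperator (ℤ ×ₗ ℤ) ℂ V V) (p q : ℤ) : Module.End ℂ V :=
  U.coeff (toLex (-p - 1, -q - 1))

theorem mode2_ext {A B : HVertexOperator (ℤ ×ₗ ℤ) ℂ V V}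
    (h : ∀ p q v, mode2 A p q v = mode2 B p q v) : A = B := by
  refine hv_ext fun a v => ?_
  have := h (-(ofLex a).1 - 1) (-(ofLex a).2 - 1) v
  simp only [mode2, neg_sub, sub_neg_eq_add, add_sub_cancel_left] at this
  exact this

theorem mode2_comp (A B : VertexOperator ℂ V) (p q : ℤ) (v : V) :
    mode2 (comp A B) p q v = (A[[q]]) ((B[[p]]) v) := rfl

theorem mode2_add (A B : HVertexOperator (ℤ ×ₗ ℤ) ℂ V V) (p q : ℤ) :
    mode2 (A + B) p q = mode2 A p q + mode2 B p q := by
  rw [mode2, map_add]; rfl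

theorem mode2_sub (A B : HVertexOperator (ℤ ×ₗ ℤ) ℂ V V) (p q : ℤ) :
    mode2 (A - B) p q = mode2 A p q - mode2 B p q := by
  rw [mode2, map_sub]; rfl

theorem mode2_smul (c : ℂ) (A : HVertexOperator (ℤ ×ₗ ℤ) ℂ V V) (p q : ℤ) :
    mode2 (c • A) p q = c • mode2 A p q := by
  rw [mode2, map_smul]; rfl

/-- In the lexicographic order the first exponent dominates, so projection to it is monotone and its
image on the support is bounded below. The bound is uniform in the other mode, which makes the
residue sums finite. -/
theorem exists_mode2_eq_zero (U : HVertexOperator (ℤ ×ₗ ℤ) ℂ V V) (v : V) :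
    ∃ N : ℤ, ∀ p, N ≤ p → ∀ q, mode2 U p q v = 0 := by
  have h : ((fun a : ℤ ×ₗ ℤ => (ofLex a).1) '' {a | U.coeff a v ≠ 0}).IsPWO :=
    (coeff_support_isPWO U v).image_of_monotone Prod.Lex.monotone_fst
  obtain ⟨b, hb⟩ : BddBelow ((fun a : ℤ ×ₗ ℤ => (ofLex a).1) '' {a | U.coeff a v ≠ 0}) := by
    rcases Set.eq_empty_or_nonempty
      ((fun a : ℤ ×ₗ ℤ => (ofLex a).1) '' {a | U.coeff a v ≠ 0}) with h0 | h0
    · rw [h0]; exact bddBelow_empty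
    · exact ⟨h.isWF.min h0, fun x hx => h.isWF.min_le h0 hx⟩
  refine ⟨-b, fun p hp q => ?_⟩
  by_contra hne
  have := hb ⟨toLex (-p - 1, -q - 1), hne, rfl⟩
  simp only [ofLex_toLex] at this
  omega

/-- Multiplication by the difference of the second and the first variable. -/
def mulDiff (U : HVertexOperator (ℤ ×ₗ ℤ) ℂ V V) : HVertexOperator (ℤ ×ₗ ℤ) ℂ V V :=
  shift (toLex (0, 1)) U - shift (toLex (1, 0)) U

theorem mode2_mulDiff (U : HVertexOperator (ℤ ×ₗ ℤ) ℂ V V) (p q : ℤ) :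
    mode2 (mulDiff U) p q = mode2 U p (q + 1) - mode2 U (p + 1) q := by
  rw [mulDiff, mode2_sub]
  simp only [mode2, coeff_shift, ← toLex_sub, Prod.mk_sub_mk]
  rw [show -p - 1 - 0 = -p - 1 by ring, show -q - 1 - 1 = -(q + 1) - 1 by ring,
    show -p - 1 - 1 = -(p + 1) - 1 by ring, show -q - 1 - 0 = -q - 1 by ring]

/-- The coefficient of `(z-w)^(-r-1)` coming from the expansion in `|z| > |w|`; the first variable
of `U` is `w`, the second one is `z`. -/
def resOut (r : ℤ) (U : HVertexOperator (ℤ ×ₗ ℤ) ℂ V V) (k : ℤ) (v : V) : V :=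
  ∑ᶠ j : ℕ, signedChoose r j • mode2 U (k + j) (r - j) v

/-- The coefficient of `(z-w)^(-r-1)` coming from the expansion in `|w| > |z|`; the first variable
of `W` is `z`, the second one is `w`. -/
def resIn (r : ℤ) (W : HVertexOperator (ℤ ×ₗ ℤ) ℂ V V) (k : ℤ) (v : V) : V :=
  (-1 : ℂ) ^ r • ∑ᶠ j : ℕ, signedChoose r j • mode2 W j (r + k - j) v

theorem out_support_finite (U : HVertexOperator (ℤ ×ₗ ℤ) ℂ V V) (c : ℕ → ℂ) (k : ℤ) (f : ℕ → ℤ)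
    (v : V) : (Function.support fun j : ℕ => c j • mode2 U (k + j) (f j) v).Finite := by
  obtain ⟨N, hN⟩ := exists_mode2_eq_zero U v
  exact support_finite_of_bound (N - k).toNat fun j hj => by rw [hN _ (by omega), smul_zero]

theorem in_support_finite (U : HVertexOperator (ℤ ×ₗ ℤ) ℂ V V) (c : ℕ → ℂ) (f : ℕ → ℤ)
    (v : V) : (Function.support fun j : ℕ => c j • mode2 U j (f j) v).Finite := by
  simpa only [zero_add] using out_support_finite U c 0 f v

theorem resOut_add (r : ℤ) (A B : HVertexOperator (ℤ ×ₗ ℤ) ℂ V V) (k : ℤ) (v : V) :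
    resOut r (A + B) k v = resOut r A k v + resOut r B k v := by
  simp only [resOut, mode2_add, LinearMap.add_apply, smul_add]
  exact finsum_add_distrib (out_support_finite _ _ _ _ _) (out_support_finite _ _ _ _ _)

theorem resIn_add (r : ℤ) (A B : HVertexOperator (ℤ ×ₗ ℤ) ℂ V V) (k : ℤ) (v : V) :
    resIn r (A + B) k v = resIn r A k v + resIn r B k v := by
  simp only [resIn, mode2_add, LinearMap.add_apply, smul_add]
  rw [finsum_add_distrib (in_support_finite A (signedChoose r) (fun j => r + k - j) v)
    (in_support_finite B (signedChoose r) (fun j => r + k - j) v), smul_add]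

theorem resOut_smul (r : ℤ) (c : ℂ) (A : HVertexOperator (ℤ ×ₗ ℤ) ℂ V V) (k : ℤ) (v : V) :
    resOut r (c • A) k v = c • resOut r A k v := by
  simp only [resOut, mode2_smul, LinearMap.smul_apply]
  rw [smul_finsum' _ (out_support_finite A (signedChoose r) k (fun j => r - j) v)]
  exact finsum_congr fun j => smul_comm _ _ _

theorem resIn_smul (r : ℤ) (c : ℂ) (A : HVertexOperator (ℤ ×ₗ ℤ) ℂ V V) (k : ℤ) (v : V) :
    resIn r (c • A) k v = c • resIn r A k v := by
  simp only [resIn, mode2_smul, LinearMap.smul_apply]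
  rw [smul_comm, smul_finsum' _ (in_support_finite A (signedChoose r) (fun j => r + k - j) v)]
  congr 1
  exact finsum_congr fun j => smul_comm _ _ _

theorem resOut_mulDiff (r : ℤ) (U : HVertexOperator (ℤ ×ₗ ℤ) ℂ V V) (k : ℤ) (v : V) :
    resOut r (mulDiff U) k v = resOut (r + 1) U k v := by
  have h := finsum_signedChoose (g := fun j : ℕ => mode2 U (k + j) (r + 1 - j) v)
    (by simpa using out_support_finite U (fun _ => 1) k (fun j => r + 1 - j) v) r
  rw [resOut, resOut, ← h]
  refine finsum_congr fun j => ?_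
  rw [mode2_mulDiff, LinearMap.sub_apply, Nat.cast_succ, add_assoc k, sub_add_eq_add_sub,
    show r + 1 - (j + 1 : ℤ) = r - j by ring]

/-- Here the first variable is `z`, so `mulDiff` multiplies by `w - z`; hence the sign, absent from
`resOut_mulDiff`. -/
theorem resIn_mulDiff (r : ℤ) (W : HVertexOperator (ℤ ×ₗ ℤ) ℂ V V) (k : ℤ) (v : V) :
    resIn r (mulDiff W) k v = -resIn (r + 1) W k v := by
  have h := finsum_signedChoose (g := fun j : ℕ => mode2 W j (r + 1 + k - j) v)
    (by simpa using in_support_finite W (fun _ => 1) (fun j => r + 1 + k - j) v) r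
  rw [resIn, resIn, ← h, zpow_add_one₀ (by norm_num), mul_neg_one, neg_smul, neg_neg]
  congr 1
  refine finsum_congr fun j => ?_
  rw [mode2_mulDiff, LinearMap.sub_apply, Nat.cast_succ, show r + k - j + 1 = r + 1 + k - (j : ℤ) by ring,
    show r + 1 + k - (j + 1 : ℤ) = r + k - j by ring]

/-! ### Residue products -/

theorem vo_ext {A B : VertexOperator ℂ V} (h : ∀ k v, (A[[k]]) v = (B[[k]]) v) : A = B :=
  hv_ext fun a v => by rw [VertexOperator.coeff_eq_ncoeff, VertexOperator.coeff_eq_ncoeff, h]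

theorem comm_iff {A B : VertexOperator ℂ V} :
    Comm A B ↔ ∀ m k v, (A[[m]]) ((B[[k]]) v) = (B[[k]]) ((A[[m]]) v) := by
  refine ⟨fun h m k v => h _ _ v, fun h a b v => ?_⟩
  rw [VertexOperator.coeff_eq_ncoeff, VertexOperator.coeff_eq_ncoeff, h]

theorem Comm.ncoeff {A B : VertexOperator ℂ V} (h : Comm A B) (m k : ℤ) (v : V) :
    (A[[m]]) ((B[[k]]) v) = (B[[k]]) ((A[[m]]) v) := h _ _ v

theorem ncoeff_add (A B : VertexOperator ℂ V) (k : ℤ) : (A + B)[[k]] = A[[k]] + B[[k]] := by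
  rw [map_add, Pi.add_apply]

theorem ncoeff_sub (A B : VertexOperator ℂ V) (k : ℤ) : (A - B)[[k]] = A[[k]] - B[[k]] := by
  rw [map_sub, Pi.sub_apply]

theorem ncoeff_smul (c : ℂ) (A : VertexOperator ℂ V) (k : ℤ) : (c • A)[[k]] = c • A[[k]] := by
  rw [map_smul, Pi.smul_apply]

theorem ncoeff_shift (g : ℤ) (A : VertexOperator ℂ V) (k : ℤ) : (shift g A)[[k]] = A[[k + g]] := by
  rw [VertexOperator.ncoeff_apply, coeff_shift, VertexOperator.ncoeff_apply,
    show -k - 1 - g = -(k + g) - 1 by ring]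

theorem ncoeff_one (k : ℤ) : (one V)[[k]] = if k = -1 then 1 else 0 := by
  rw [one, ncoeff_ofModes]

theorem ncoeff_der (A : VertexOperator ℂ V) (k : ℤ) : (der A)[[k]] = (-(k : ℂ)) • A[[k - 1]] := by
  rw [der, ncoeff_ofModes]

theorem mul_support_finite_left {A B : VertexOperator ℂ V} (h : Comm A B) (k : ℤ) (v : V) :
    (Function.support fun a : ℤ => (A[[a]]) ((B[[k - a]]) v)).Finite := by
  refine ((mul_support_finite h (-k - 2) v).preimage
    (f := fun a : ℤ => -a - 1) fun a _ b _ h => by simpa using h).subset fun a ha => ?_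
  refine fun h0 => ha ?_
  dsimp only at h0 ⊢
  rw [← h0, VertexOperator.ncoeff_apply, VertexOperator.ncoeff_apply,
    show -k - 2 - (-a - 1) = -(k - a) - 1 by ring]

theorem ncoeff_mul_left {A B : VertexOperator ℂ V} (h : Comm A B) (k : ℤ) (v : V) :
    ((mul A B)[[k]]) v = ∑ᶠ a : ℤ, (A[[a]]) ((B[[k - 1 - a]]) v) := by
  rw [VertexOperator.ncoeff_apply, coeff_mul h, ← finsum_comp_equiv (Equiv.subLeft (-1 : ℤ))]
  refine finsum_congr fun a => ?_
  rw [VertexOperator.ncoeff_apply, VertexOperator.ncoeff_apply, Equiv.subLeft_apply,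
    show -1 - a = -a - 1 by ring, show -k - 1 - (-a - 1) = -(k - 1 - a) - 1 by ring]

theorem mul_support_finite_right {A B : VertexOperator ℂ V} (h : Comm A B) (k : ℤ) (v : V) :
    (Function.support fun a : ℤ => (A[[k - a]]) ((B[[a]]) v)).Finite := by
  simpa only [h.ncoeff] using mul_support_finite_left h.symm k v

theorem ncoeff_mul_right {A B : VertexOperator ℂ V} (h : Comm A B) (k : ℤ) (v : V) :
    ((mul A B)[[k]]) v = ∑ᶠ a : ℤ, (A[[k - 1 - a]]) ((B[[a]]) v) := by
  rw [mul_comm_of_comm h, ncoeff_mul_left h.symm]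
  exact finsum_congr fun a => (h.ncoeff _ _ _).symm

theorem ncoeff_resProd (A B : VertexOperator ℂ V) (r k : ℤ) (v : V) :
    ((resProd A B r)[[k]]) v = ∑ᶠ j : ℕ, resTerm A B r k j v := by
  rw [resProd, ncoeff_ofModes]
  rfl

theorem resTerm_apply (A B : VertexOperator ℂ V) (r k : ℤ) (j : ℕ) (v : V) :
    resTerm A B r k j v = signedChoose r j •
      ((A[[r - j]]) ((B[[k + j]]) v) - ((-1 : ℂ) ^ r) • (B[[r + k - j]]) ((A[[(j : ℤ)]]) v)) := rfl

theorem ncoeff_resProd_eq_sub (A B : VertexOperator ℂ V) (r k : ℤ) (v : V) :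
    ((resProd A B r)[[k]]) v = resOut r (comp A B) k v - resIn r (comp B A) k v := by
  rw [ncoeff_resProd, resOut, resIn,
    smul_finsum' _ (in_support_finite (comp B A) (signedChoose r) (fun j => r + k - j) v),
    ← finsum_sub_distrib (out_support_finite (comp A B) (signedChoose r) k (fun j => r - j) v)]
  · refine finsum_congr fun j => ?_
    rw [resTerm_apply, smul_sub, smul_comm (signedChoose r j)]
    rfl
  · exact (in_support_finite (comp B A) (signedChoose r) (fun j => r + k - j) v).subset
      fun j hj h => hj (by simp only [h, smul_zero])

theorem comp_add_left (A B C : VertexOperator ℂ V) : comp (A + B) C = comp A C + comp B C :=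
  mode2_ext fun p q v => by
    simp only [mode2_add, LinearMap.add_apply, mode2_comp, ncoeff_add]

theorem comp_add_right (A B C : VertexOperator ℂ V) : comp A (B + C) = comp A B + comp A C :=
  mode2_ext fun p q v => by
    simp only [mode2_add, LinearMap.add_apply, mode2_comp, ncoeff_add, map_add]

theorem comp_smul_left (c : ℂ) (A B : VertexOperator ℂ V) : comp (c • A) B = c • comp A B :=
  mode2_ext fun p q v => by
    simp only [mode2_smul, LinearMap.smul_apply, mode2_comp, ncoeff_smul]

theorem comp_smul_right (c : ℂ) (A B : VertexOperator ℂ V) : comp A (c • B) = c • comp A B :=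
  mode2_ext fun p q v => by
    simp only [mode2_smul, LinearMap.smul_apply, mode2_comp, ncoeff_smul, map_smul]

theorem resProd_add_left (A B C : VertexOperator ℂ V) (r : ℤ) :
    resProd (A + B) C r = resProd A C r + resProd B C r :=
  vo_ext fun k v => by
    rw [ncoeff_add, LinearMap.add_apply]
    simp only [ncoeff_resProd_eq_sub, comp_add_left, comp_add_right, resOut_add, resIn_add]
    abel

theorem resProd_add_right (A B C : VertexOperator ℂ V) (r : ℤ) :
    resProd A (B + C) r = resProd A B r + resProd A C r :=
  vo_ext fun k v => by
    rw [ncoeff_add, LinearMap.add_apply]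
    simp only [ncoeff_resProd_eq_sub, comp_add_left, comp_add_right, resOut_add, resIn_add]
    abel

theorem resProd_smul_left (c : ℂ) (A B : VertexOperator ℂ V) (r : ℤ) :
    resProd (c • A) B r = c • resProd A B r :=
  vo_ext fun k v => by
    rw [ncoeff_smul, LinearMap.smul_apply]
    simp only [ncoeff_resProd_eq_sub, comp_smul_left, comp_smul_right, resOut_smul, resIn_smul,
      smul_sub]

theorem resProd_smul_right (c : ℂ) (A B : VertexOperator ℂ V) (r : ℤ) :
    resProd A (c • B) r = c • resProd A B r :=
  vo_ext fun k v => by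
    rw [ncoeff_smul, LinearMap.smul_apply]
    simp only [ncoeff_resProd_eq_sub, comp_smul_left, comp_smul_right, resOut_smul, resIn_smul,
      smul_sub]

theorem resProd_neg_left (A B : VertexOperator ℂ V) (r : ℤ) :
    resProd (-A) B r = -resProd A B r := by
  rw [← neg_one_smul ℂ A, resProd_smul_left]
  exact neg_one_smul ℂ (resProd A B r)

theorem resProd_shift_right (A B : VertexOperator ℂ V) (g r : ℤ) :
    resProd A (shift g B) r = shift g (resProd A B r) := by
  refine vo_ext fun k v => ?_
  rw [ncoeff_shift, ncoeff_resProd, ncoeff_resProd]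
  refine finsum_congr fun j => ?_
  rw [resTerm_apply, resTerm_apply, ncoeff_shift, ncoeff_shift, add_right_comm k,
    show r + k - j + g = r + (k + g) - (j : ℤ) by ring]

/-- If `d` acts as a derivation on `A` and `B`, it acts as a derivation on their products. -/
theorem resProd_derivation {A B A' B' : VertexOperator ℂ V} {d : Module.End ℂ V}
    (hA : ∀ m v, d ((A[[m]]) v) = (A[[m]]) (d v) + (A'[[m]]) v)
    (hB : ∀ m v, d ((B[[m]]) v) = (B[[m]]) (d v) + (B'[[m]]) v) (r k : ℤ) (v : V) :
    d (((resProd A B r)[[k]]) v) =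
      ((resProd A B r)[[k]]) (d v) + ((resProd A' B r + resProd A B' r)[[k]]) v := by
  rw [ncoeff_add, LinearMap.add_apply]
  simp only [ncoeff_resProd]
  rw [map_finsum d (resTerm_support_finite A B r k v),
    ← finsum_add_distrib (resTerm_support_finite A' B r k v) (resTerm_support_finite A B' r k v),
    ← finsum_add_distrib (resTerm_support_finite A B r k (d v))]
  · refine finsum_congr fun j => ?_
    simp only [resTerm_apply, map_smul, map_sub, hA, hB, map_add, smul_sub, smul_add]
    abel
  · refine ((resTerm_support_finite A' B r k v).union
      (resTerm_support_finite A B' r k v)).subset fun j hj => ?_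
    by_contra h
    rw [Set.mem_union, not_or, Function.notMem_support, Function.notMem_support] at h
    exact hj (by simp only [h.1, h.2, add_zero])

theorem Comm.resProd_right {A B C : VertexOperator ℂ V} (hA : Comm C A) (hB : Comm C B) (r : ℤ) :
    Comm C (resProd A B r) := by
  refine comm_iff.2 fun m k v => ?_
  rw [ncoeff_resProd, ncoeff_resProd, map_finsum _ (resTerm_support_finite A B r k v)]
  refine finsum_congr fun j => ?_
  simp only [resTerm_apply, map_smul, map_sub, hA.ncoeff, hB.ncoeff]

/-- The modes of `B` pass through every term of the residue product, so `B` factors out once the two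
sums are interchanged. This lets `D_i` act on its own factor alone. -/
theorem resProd_mul {A B C : VertexOperator ℂ V} (hAB : Comm A B) (hCB : Comm C B) (r : ℤ) :
    resProd A (mul C B) r = mul (resProd A C r) B := by
  have hcomm : ∀ k j m v, (B[[m]]) (resTerm A C r k j v) = resTerm A C r k j ((B[[m]]) v) :=
    fun k j m v => by
      simp only [resTerm_apply, map_smul, map_sub, hAB.symm.ncoeff, hCB.symm.ncoeff]
  refine vo_ext fun k v => ?_
  rw [ncoeff_resProd, ncoeff_mul_right (hAB.symm.resProd_right hCB.symm r).symm]
  simp only [ncoeff_resProd]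
  rw [← finsum_comm_of_finite]
  · refine finsum_congr fun j => ?_
    have h1 := mul_support_finite_right hCB (k + j - 1) v
    have h2 := mul_support_finite_right hCB (r + k - j - 1) ((A[[(j : ℤ)]]) v)
    have h3 : (Function.support fun a : ℤ => (A[[r - j]])
        ((C[[k + j - 1 - a]]) ((B[[a]]) v))).Finite :=
      h1.subset fun a ha h => ha (by simp only [h, map_zero])
    have h4 : (Function.support fun a : ℤ => ((-1 : ℂ) ^ r) • ((C[[r + k - j - 1 - a]])
        ((B[[a]]) ((A[[(j : ℤ)]]) v)))).Finite :=
      h2.subset fun a ha h => ha (by simp only [h, smul_zero])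
    rw [resTerm_apply, ncoeff_mul_right hCB, ncoeff_mul_right hCB, map_finsum _ h1,
      smul_finsum' _ h2, ← finsum_sub_distrib h3 h4, smul_finsum']
    · refine finsum_congr fun a => ?_
      rw [resTerm_apply, ← hAB.ncoeff, show k + j - 1 - a = k - 1 - a + j by ring,
        show r + k - j - 1 - a = r + (k - 1 - a) - j by ring]
    · refine (h3.union h4).subset fun a ha => ?_
      by_contra h
      rw [Set.mem_union, not_or, Function.notMem_support, Function.notMem_support] at h
      exact ha (by simp only [h.1, h.2, sub_zero])
  -- Joint finiteness: `m` is bounded above because `B_m v` vanishes for large `m`. It is bounded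
  -- below because `B_m` can be moved to the outside, where the terms with mode `k - 1 - m` of the
  -- product vanish on `v` uniformly in `j`.
  · obtain ⟨N, hN⟩ := exists_ncoeff_eq_zero B v
    obtain ⟨M, hM⟩ := resTerm_eventually_zero A C r v
    refine ((Set.finite_Icc (k - 1 - M) N).biUnion fun m _ =>
      (resTerm_support_finite A C r (k - 1 - m) ((B[[m]]) v)).image fun j => (j, m)).subset ?_
    rintro ⟨j, m⟩ hjm
    rw [Set.mem_iUnion₂]
    refine ⟨m, ⟨?_, ?_⟩, j, hjm, rfl⟩
    · by_contra h
      refine hjm ?_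
      dsimp only
      rw [← hcomm, hM _ (by omega), map_zero]
    · by_contra h
      refine hjm ?_
      dsimp only
      rw [hN _ (by omega), map_zero]

theorem ncoeff_prod_zero (A B : VertexOperator ℂ V) (k : ℤ) (v : V) :
    ((prod 0 A B)[[k]]) v =
      ∑ᶠ j : ℕ, ((A[[-1 - j]]) ((B[[k + j]]) v) + (B[[k - 1 - j]]) ((A[[(j : ℤ)]]) v)) := by
  rw [prod, zero_sub, ncoeff_resProd]
  refine finsum_congr fun j => ?_
  rw [resTerm_apply, signedChoose_neg_one, one_smul, zpow_neg_one, inv_neg_one, neg_one_smul,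
    sub_neg_eq_add, show -1 + k - (j : ℤ) = k - 1 - j by ring]

theorem add_support_finite (B : VertexOperator ℂ V) (f : ℕ → Module.End ℂ V) (k : ℤ) (v : V) :
    (Function.support fun j : ℕ => f j ((B[[k + j]]) v)).Finite := by
  obtain ⟨N, hN⟩ := exists_ncoeff_eq_zero B v
  exact support_finite_of_bound (N - k).toNat fun j hj => by rw [hN _ (by omega), map_zero]

theorem ncoeff_prod_zero' (A B : VertexOperator ℂ V) (k : ℤ) (v : V) :
    ((prod 0 A B)[[k]]) v =
      ∑ᶠ j : ℕ, (A[[-1 - j]]) ((B[[k + j]]) v) +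
        ∑ᶠ j : ℕ, (B[[k - 1 - j]]) ((A[[(j : ℤ)]]) v) := by
  rw [ncoeff_prod_zero, finsum_add_distrib (add_support_finite B (fun j => A[[-1 - j]]) k v)]
  have h := add_support_finite A (fun j => B[[k - 1 - j]]) 0 v
  simp only [zero_add] at h
  exact h

/-- Without a commutator the two halves of the normally ordered product fit together to the full sum
over the modes of `B`. -/
theorem prod_zero_eq_mul {A B : VertexOperator ℂ V} (h : Comm A B) : prod 0 A B = mul A B := by
  refine vo_ext fun k v => ?_
  rw [ncoeff_prod_zero', ncoeff_mul_left h,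
    finsum_int_split (mul_support_finite_left h (k - 1) v) 0, add_comm]
  congr 1
  · refine finsum_congr fun j => ?_
    rw [← h.ncoeff, zero_add]
  · refine finsum_congr fun j => ?_
    rw [show k - 1 - (0 - 1 - (j : ℤ)) = k + j by ring, zero_sub]

/-- The field `shift g (one V)` is the scalar `w^g`, the form in which commutators of one mode with
a free field appear. -/
theorem comm_shift_one (A : VertexOperator ℂ V) (g : ℤ) : Comm A (shift g (one V)) := by
  refine comm_iff.2 fun m k v => ?_
  rw [ncoeff_shift, ncoeff_one]
  split_ifs <;> simp

theorem shift_zero (A : VertexOperator ℂ V) : shift 0 A = A :=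
  vo_ext fun k v => by rw [ncoeff_shift, add_zero]

theorem comm_one (A : VertexOperator ℂ V) : Comm A (one V) := by
  simpa only [shift_zero] using comm_shift_one A 0

theorem mul_one (A : VertexOperator ℂ V) : mul A (one V) = A := by
  refine vo_ext fun k v => ?_
  rw [ncoeff_mul_right (comm_one A), finsum_eq_single _ (-1)]
  · rw [ncoeff_one, if_pos rfl, Module.End.one_apply, sub_neg_eq_add, sub_add_cancel]
  · intro a ha
    rw [ncoeff_one, if_neg ha, LinearMap.zero_apply, map_zero]

theorem prod_zero_shift_one (A : VertexOperator ℂ V) (g : ℤ) :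
    prod 0 A (shift g (one V)) = shift g A := by
  rw [prod_zero_eq_mul (comm_shift_one A g), mul_shift_right (comm_one A), mul_one]

theorem prod_zero_shift_one_left (A : VertexOperator ℂ V) (g : ℤ) :
    prod 0 (shift g (one V)) A = shift g A := by
  rw [prod_zero_eq_mul (comm_shift_one A g).symm, ← mul_comm_of_comm (comm_shift_one A g),
    mul_shift_right (comm_one A), mul_one]

theorem prod_zero_one (A : VertexOperator ℂ V) : prod 0 A (one V) = A := by
  simpa only [shift_zero] using prod_zero_shift_one A 0

/-- The residue product with a derivative. -/
theorem resProd_der (A B : VertexOperator ℂ V) (r : ℤ) :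
    resProd (der A) B r = (-(r : ℂ)) • resProd A B (r - 1) := by
  -- Absorption identities: this one matches the outer expansion, and `habs2` the inner one, where
  -- the summation index is shifted by one.
  have habs : ∀ j : ℕ, ((r : ℂ) - j) * signedChoose r j = r * signedChoose (r - 1) j := by
    intro j
    induction j with
    | zero => rw [signedChoose_zero, signedChoose_zero, Nat.cast_zero, sub_zero]
    | succ j ih =>
      have h1 := signedChoose_succ (r - 1) j
      rw [sub_add_cancel] at h1
      have h2 : ((j : ℂ) + 1) * signedChoose r (j + 1) = -(r - j) * signedChoose r j := by
        have h := Ring.descPochhammer_eq_factorial_smul_choose r (j + 1)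
        have h' := Ring.descPochhammer_eq_factorial_smul_choose r j
        rw [descPochhammer_succ_right, Polynomial.smeval_mul, h'] at h
        have h3 : ((j : ℤ) + 1) * Ring.choose r (j + 1) = (r - j) * Ring.choose r j := by
          have hf : (j.factorial : ℤ) ≠ 0 := by positivity
          simp only [Polynomial.smeval_sub, Polynomial.smeval_X, Polynomial.smeval_natCast,
            pow_one, pow_zero, nsmul_eq_mul, Nat.factorial_succ, Nat.cast_mul, Nat.cast_succ,
            _root_.mul_one] at h
          refine mul_left_cancel₀ hf ?_
          linear_combination -h
        have h4 := congrArg (Int.cast : ℤ → ℂ) h3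
        push_cast at h4
        rw [signedChoose, signedChoose, pow_succ]
        linear_combination (-1) ^ j * (-1) * h4
      push_cast
      linear_combination r * h1 - h2 + ih
  have habs2 : ∀ j : ℕ, ((j : ℂ) + 1) * signedChoose r (j + 1) = -(r * signedChoose (r - 1) j) := by
    intro j
    have h1 := signedChoose_succ (r - 1) j
    rw [sub_add_cancel] at h1
    have h2 := habs (j + 1)
    push_cast at h2
    linear_combination r * h1 - h2
  refine vo_ext fun k v => ?_
  rw [ncoeff_smul, LinearMap.smul_apply, ncoeff_resProd_eq_sub, ncoeff_resProd_eq_sub, smul_sub]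
  congr 1
  · rw [resOut, resOut, smul_finsum' _
      (out_support_finite (comp A B) (signedChoose (r - 1)) k (fun j => r - 1 - j) v)]
    refine finsum_congr fun j => ?_
    rw [mode2_comp, mode2_comp, ncoeff_der, LinearMap.smul_apply, smul_smul, smul_smul,
      sub_right_comm]
    congr 1
    push_cast
    linear_combination -habs j
  -- The mode `0` of a derivative vanishes, so the term `j = 0` drops out and the rest is reindexed.
  · rw [resIn, resIn, finsum_nat_succ
      (in_support_finite (comp B (der A)) (signedChoose r) (fun j => r + k - j) v), smul_comm,
      smul_finsum' (-(r : ℂ))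
      (in_support_finite (comp B A) (signedChoose (r - 1)) (fun j => r - 1 + k - j) v),
      mode2_comp, ncoeff_der]
    simp only [Nat.cast_zero, Int.cast_zero, neg_zero, zero_smul, LinearMap.zero_apply, map_zero,
      smul_zero, zero_add]
    rw [zpow_sub_one₀ (by norm_num), inv_neg_one, mul_neg_one, neg_smul, ← smul_neg,
      ← finsum_neg_distrib]
    congr 1
    refine finsum_congr fun j => ?_
    rw [mode2_comp, mode2_comp, ncoeff_der, LinearMap.smul_apply, map_smul, smul_smul, smul_smul,
      ← neg_smul, Nat.cast_succ, show r + k - (j + 1 : ℤ) = r - 1 + k - j by ring,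
      add_sub_cancel_right]
    congr 1
    push_cast
    linear_combination -habs2 j

/-! ### Iterated normally ordered products -/

theorem support_prod_finite {W : Type*} [AddCommGroup W] {f : ℕ × ℕ → W} (N : ℕ)
    (h1 : ∀ i j, N ≤ i → f (i, j) = 0) (h2 : ∀ i, ∃ M : ℕ, ∀ j, M ≤ j → f (i, j) = 0) :
    (Function.support f).Finite := by
  choose M hM using h2
  refine ((Set.finite_Iio N).biUnion fun i _ => (Set.finite_Iio (M i)).image
    (Prod.mk i)).subset ?_
  rintro ⟨i, j⟩ hij
  rw [Set.mem_iUnion₂]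
  refine ⟨i, ?_, j, ?_, rfl⟩
  · by_contra h
    exact hij (h1 i j (not_lt.1 h))
  · by_contra h
    exact hij (hM i j (not_lt.1 h))

theorem support_prod_finite' {W : Type*} [AddCommGroup W] {f : ℕ × ℕ → W} (N : ℕ)
    (h1 : ∀ i j, N ≤ j → f (i, j) = 0) (h2 : ∀ j, ∃ M : ℕ, ∀ i, M ≤ i → f (i, j) = 0) :
    (Function.support f).Finite := by
  refine ((support_prod_finite (f := fun p => f p.swap) N (fun i j => h1 j i)
    h2).image Prod.swap).subset fun p hp => ⟨p.swap, ?_, Prod.swap_swap p⟩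
  simpa using hp

theorem support_finsum_finite {α β W : Type*} [AddCommGroup W] {f : α × β → W}
    (hf : (Function.support f).Finite) : (Function.support fun i => ∑ᶠ j, f (i, j)).Finite := by
  refine (hf.image Prod.fst).subset fun i hi => ?_
  by_contra h
  refine hi ((finsum_congr fun j => ?_).trans finsum_zero)
  by_contra h'
  exact h ⟨(i, j), h', rfl⟩

/-- Each of `A` and `B` enters through its creation part to the left of `F` or its annihilation part
to the right of `F`. Exchanging `A` and `B` swaps the two mixed sums. -/
theorem ncoeff_prod_zero_prod_zero (A B F : VertexOperator ℂ V) (k : ℤ) (v : V) :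
    ((prod 0 A (prod 0 B F))[[k]]) v =
      ∑ᶠ p : ℕ × ℕ, (A[[-1 - p.1]]) ((B[[-1 - p.2]]) ((F[[k + p.1 + p.2]]) v)) +
      ∑ᶠ p : ℕ × ℕ, (A[[-1 - p.1]]) ((F[[k + p.1 - 1 - p.2]]) ((B[[(p.2 : ℤ)]]) v)) +
      (∑ᶠ p : ℕ × ℕ, (B[[-1 - p.2]]) ((F[[k - 1 - p.1 + p.2]]) ((A[[(p.1 : ℤ)]]) v)) +
      ∑ᶠ p : ℕ × ℕ, (F[[k - 1 - p.1 - 1 - p.2]]) ((B[[(p.2 : ℤ)]]) ((A[[(p.1 : ℤ)]]) v))) := by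
  have f1 : (Function.support fun p : ℕ × ℕ =>
      (A[[-1 - p.1]]) ((B[[-1 - p.2]]) ((F[[k + p.1 + p.2]]) v))).Finite := by
    obtain ⟨N, hN⟩ := exists_ncoeff_eq_zero F v
    refine support_prod_finite (N - k).toNat (fun i j h => ?_) fun i => ⟨(N - k - i).toNat,
      fun j h => ?_⟩ <;>
    · dsimp only
      rw [hN _ (by omega), map_zero, map_zero]
  have f2 : (Function.support fun p : ℕ × ℕ =>
      (A[[-1 - p.1]]) ((F[[k + p.1 - 1 - p.2]]) ((B[[(p.2 : ℤ)]]) v))).Finite := by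
    obtain ⟨N, hN⟩ := exists_ncoeff_eq_zero B v
    refine support_prod_finite' N.toNat (fun i j h => ?_) fun j => ?_
    · dsimp only
      rw [hN _ (by omega), map_zero, map_zero]
    · obtain ⟨M, hM⟩ := exists_ncoeff_eq_zero F ((B[[(j : ℤ)]]) v)
      refine ⟨(M - k + 1 + j).toNat, fun i hi => ?_⟩
      dsimp only
      rw [hM _ (by omega), map_zero]
  have f3 : (Function.support fun p : ℕ × ℕ =>
      (B[[-1 - p.2]]) ((F[[k - 1 - p.1 + p.2]]) ((A[[(p.1 : ℤ)]]) v))).Finite := by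
    obtain ⟨N, hN⟩ := exists_ncoeff_eq_zero A v
    refine support_prod_finite N.toNat (fun i j h => ?_) fun j => ?_
    · dsimp only
      rw [hN _ (by omega), map_zero, map_zero]
    · obtain ⟨M, hM⟩ := exists_ncoeff_eq_zero F ((A[[(j : ℤ)]]) v)
      refine ⟨(M - k + 1 + j).toNat, fun i hi => ?_⟩
      dsimp only
      rw [hM _ (by omega), map_zero]
  have f4 : (Function.support fun p : ℕ × ℕ =>
      (F[[k - 1 - p.1 - 1 - p.2]]) ((B[[(p.2 : ℤ)]]) ((A[[(p.1 : ℤ)]]) v))).Finite := by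
    obtain ⟨N, hN⟩ := exists_ncoeff_eq_zero A v
    refine support_prod_finite N.toNat (fun i j h => ?_) fun j => ?_
    · dsimp only
      rw [hN _ (by omega), map_zero, map_zero]
    · obtain ⟨M, hM⟩ := exists_ncoeff_eq_zero B ((A[[(j : ℤ)]]) v)
      refine ⟨M.toNat, fun i hi => ?_⟩
      dsimp only
      rw [hM _ (by omega), map_zero]
  rw [finsum_curry _ f1, finsum_curry _ f2, finsum_curry _ f3, finsum_curry _ f4,
    ← finsum_add_distrib (support_finsum_finite f1) (support_finsum_finite f2), ← finsum_add_distrib (support_finsum_finite f3) (support_finsum_finite f4),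
    ncoeff_prod_zero']
  congr 1
  · refine finsum_congr fun j => ?_
    rw [ncoeff_prod_zero', map_add, map_finsum _
      (add_support_finite F (fun i => B[[-1 - i]]) (k + j) v)]
    congr 1
    have := add_support_finite B (fun i => F[[k + j - 1 - i]]) 0 v
    simp only [zero_add] at this
    rw [map_finsum _ this]
  · refine finsum_congr fun j => ?_
    rw [ncoeff_prod_zero']

/-- Normally ordered multiplication operators commute if the creation parts and the annihilation
parts of the two factors commute. -/
theorem prod_zero_left_comm {A B : VertexOperator ℂ V}
    (hneg : ∀ (i j : ℕ) v, (A[[-1 - i]]) ((B[[-1 - j]]) v) = (B[[-1 - j]]) ((A[[-1 - i]]) v))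
    (hpos : ∀ (i j : ℕ) v, (A[[(i : ℤ)]]) ((B[[(j : ℤ)]]) v) = (B[[(j : ℤ)]]) ((A[[(i : ℤ)]]) v))
    (F : VertexOperator ℂ V) : prod 0 A (prod 0 B F) = prod 0 B (prod 0 A F) := by
  refine vo_ext fun k v => ?_
  have key : ∀ a b c d a' b' c' d' : V, a = a' → b = c' → c = b' → d = d' →
      a + b + (c + d) = a' + b' + (c' + d') := by
    rintro a b c d _ _ _ _ rfl rfl rfl rfl
    exact add_add_add_comm a b c d
  rw [ncoeff_prod_zero_prod_zero, ncoeff_prod_zero_prod_zero]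
  refine key _ _ _ _ _ _ _ _ ?_ ?_ ?_ ?_ <;> rw [← finsum_comp_equiv (Equiv.prodComm ℕ ℕ)] <;>
    refine finsum_congr fun p => ?_ <;> rw [Equiv.prodComm_apply, Prod.fst_swap, Prod.snd_swap]
  · rw [hneg, add_right_comm]
  · rw [show k + (p.2 : ℤ) - 1 - p.1 = k - 1 - p.1 + p.2 by ring]
  · rw [show k - 1 - (p.2 : ℤ) + p.1 = k + p.1 - 1 - p.2 by ring]
  · rw [hpos, show k - 1 - (p.2 : ℤ) - 1 - p.1 = k - 1 - p.1 - 1 - p.2 by ring]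

/-- Associativity of the normally ordered product up to a derivative, for the product of `Y`
with a field `X` and a field `F` commuting with `X`. -/
theorem ncoeff_prod_zero_shift {X Y F G : VertexOperator ℂ V} (hXF : Comm X F) (hXG : Comm X G)
    (hYF : ∀ k m v, (Y[[k]]) ((F[[m]]) v) = (F[[m]]) ((Y[[k]]) v) - (G[[m + k]]) v)
    (m k : ℤ) (v : V) :
    ((prod 0 (shift m (prod 0 Y X)) F)[[k]]) v = ((prod 0 Y (mul X F))[[k + m]]) v -
      ∑ᶠ a : ℤ, ((m : ℂ) - 1 - a) • (X[[a]]) ((G[[m + k - 2 - a]]) v) := by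
  set t1 : ℤ → ℤ → ℕ → V := fun a b i => (Y[[-1 - i]]) ((X[[a + i]]) ((F[[b]]) v)) with ht1
  set t2 : ℤ → ℤ → ℕ → V := fun a b i => (X[[a - 1 - i]]) ((F[[b]]) ((Y[[(i : ℤ)]]) v)) with ht2
  set x : ℤ → V := fun a => (X[[a]]) ((G[[m + k - 2 - a]]) v) with hx
  have hxfin : (Function.support x).Finite := mul_support_finite_left hXG (m + k - 2) v
  have hxpos : ∀ c : ℤ, (Function.support fun j : ℕ => x (c + j)).Finite := fun c =>
    hxfin.preimage (f := fun j : ℕ => c + (j : ℤ)) fun a _ b _ h => by simpa using h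
  have hxneg : ∀ c : ℤ, (Function.support fun j : ℕ => x (c - j)).Finite := fun c =>
    hxfin.preimage (f := fun j : ℕ => c - (j : ℤ)) fun a _ b _ h => by simpa using h
  have h1fin : ∀ a b, (Function.support (t1 a b)).Finite := fun a b =>
    add_support_finite X (fun i => Y[[-1 - i]]) a ((F[[b]]) v)
  have h2fin : ∀ a b, (Function.support (t2 a b)).Finite := fun a b => by
    have := add_support_finite Y (fun i => X[[a - 1 - i]] * F[[b]]) 0 v
    simp only [zero_add] at this
    exact this
  -- The nonnegative modes of `Y` must move to the right past `F`, and each exchange leaves a term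
  -- in `X` and `G`, recorded by `x`.
  have hJF : ∀ j : ℕ, (((prod 0 Y X))[[-1 - j + m]]) ((F[[k + j]]) v) =
      ∑ᶠ i, (t1 (m - 1 - j) (k + j) i + t2 (m - 1 - j) (k + j) i) -
        ∑ᶠ i : ℕ, x (m - 2 - (j + i : ℕ)) := fun j => by
    rw [ncoeff_prod_zero, ← finsum_sub_distrib]
    · refine finsum_congr fun i => ?_
      rw [hYF, map_sub, ht1, ht2, hx]
      dsimp only
      rw [show -1 - (j : ℤ) + m = m - 1 - j by ring,
        show m - 1 - (j : ℤ) - 1 - i = m - 2 - (j + i : ℕ) by push_cast; ring,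
        show m + k - 2 - (m - 2 - ((j + i : ℕ) : ℤ)) = k + j + i by push_cast; ring]
      abel
    · exact ((h1fin _ _).union (h2fin _ _)).subset (Function.support_add _ _)
    · refine (hxneg (m - 2 - j)).subset fun i hi h => hi ?_
      dsimp only at h ⊢
      rw [← h]
      congr 1
      push_cast
      ring
  -- Here the negative modes of `Y` move to the left past `F`, which gives the correction the
  -- opposite sign.
  have hFJ : ∀ j : ℕ, (F[[k - 1 - j]]) (((prod 0 Y X)[[j + m]]) v) =
      ∑ᶠ i, (t1 (m + j) (k - 1 - j) i + t2 (m + j) (k - 1 - j) i) +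
        ∑ᶠ i : ℕ, x (m + (j + i : ℕ)) := fun j => by
    rw [ncoeff_prod_zero, map_finsum, ← finsum_add_distrib]
    · refine finsum_congr fun i => ?_
      have h := hYF (-1 - i) (k - 1 - j) ((X[[(j : ℤ) + m + i]]) v)
      rw [map_add, ← sub_add_cancel ((F[[k - 1 - (j : ℤ)]]) ((Y[[-1 - (i : ℤ)]])
        ((X[[(j : ℤ) + m + i]]) v))) ((G[[k - 1 - j + (-1 - (i : ℤ))]])
          ((X[[(j : ℤ) + m + i]]) v)), ← h, ht1, ht2, hx]
      dsimp only
      rw [← hXF.ncoeff, ← hXF.ncoeff, ← hXG.ncoeff,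
        show (j : ℤ) + m = m + j by ring,
        show m + k - 2 - (m + ((j + i : ℕ) : ℤ)) = k - 1 - j + (-1 - i) by push_cast; ring,
        show m + ((j + i : ℕ) : ℤ) = m + j + i by push_cast; ring]
      abel
    · exact ((h1fin _ _).union (h2fin _ _)).subset (Function.support_add _ _)
    · refine (hxpos (m + j)).subset fun i hi h => hi ?_
      dsimp only at h ⊢
      rw [← h]
      congr 1
      push_cast
      ring
    · refine ((add_support_finite X (fun i => Y[[-1 - i]]) (j + m) v).union
        (s := Function.support fun i : ℕ => (Y[[-1 - (i : ℤ)]]) ((X[[j + m + (i : ℤ)]]) v))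
        (t := Function.support fun i : ℕ => (X[[j + m - 1 - (i : ℤ)]]) ((Y[[(i : ℤ)]]) v))
        ?_).subset (Function.support_add _ _)
      have := add_support_finite Y (fun i => X[[j + m - 1 - i]]) 0 v
      simp only [zero_add] at this
      exact this
  have j1 : (Function.support fun p : ℤ × ℕ => t1 p.1 (k + m - 1 - p.1) p.2).Finite := by
    obtain ⟨N, hN⟩ := exists_ncoeff_eq_zero F v
    obtain ⟨M, hM⟩ := exists_ncoeff_eq_zero X v
    refine ((Set.finite_Icc (k + m - 1 - N) M).prod
      (Set.finite_Iio (M - (k + m - 1 - N)).toNat)).subset fun p hp => ?_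
    have h1 : k + m - 1 - p.1 < N := by
      by_contra h
      exact hp (by rw [ht1]; dsimp only; rw [hN _ (by omega), map_zero, map_zero])
    have h2 : p.1 + p.2 < M := by
      by_contra h
      exact hp (by rw [ht1]; dsimp only; rw [hXF.ncoeff, hM _ (by omega), map_zero, map_zero])
    exact ⟨⟨by omega, by omega⟩, Set.mem_Iio.2 (by omega)⟩
  have j2 : (Function.support fun p : ℤ × ℕ => t2 p.1 (k + m - 1 - p.1) p.2).Finite := by
    obtain ⟨N, hN⟩ := exists_ncoeff_eq_zero Y v
    refine ((Set.finite_Iio N.toNat).biUnion fun i _ =>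
      (((mul_support_finite_left hXF (k + m - 2 - i) ((Y[[(i : ℤ)]]) v)).image
        fun a => a + 1 + (i : ℤ)).image fun a => (a, i))).subset ?_
    rintro ⟨a, i⟩ hp
    rw [Set.mem_iUnion₂]
    refine ⟨i, ?_, a, ⟨a - 1 - i, fun h => hp ?_, by ring⟩, rfl⟩
    · by_contra h
      rw [Set.mem_Iio] at h
      exact hp (by rw [ht2]; dsimp only; rw [hN _ (by omega), map_zero, map_zero])
    · rw [ht2]
      dsimp only at h ⊢
      rw [← h, show k + m - 2 - (i : ℤ) - (a - 1 - i) = k + m - 1 - a by ring]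
  -- After these moves the ordered terms depend only on the total mode `a` of `(Y X)_0`, and the two
  -- halves of the outer product together run over all `a`.
  set τ : ℤ → V := fun a => ∑ᶠ i, (t1 a (k + m - 1 - a) i + t2 a (k + m - 1 - a) i) with hτ
  have hτfin : (Function.support τ).Finite :=
    support_finsum_finite (f := fun p : ℤ × ℕ => t1 p.1 (k + m - 1 - p.1) p.2 +
      t2 p.1 (k + m - 1 - p.1) p.2) ((j1.union j2).subset (Function.support_add _ _))
  have hτpos : (Function.support fun j : ℕ => τ (m + j)).Finite :=
    hτfin.preimage (f := fun j : ℕ => m + (j : ℤ)) fun a _ b _ h => by simpa using h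
  have hτneg : (Function.support fun j : ℕ => τ (m - 1 - j)).Finite :=
    hτfin.preimage (f := fun j : ℕ => m - 1 - (j : ℤ)) fun a _ b _ h => by simpa using h
  have hτsum : ∑ᶠ a, τ a = ((prod 0 Y (mul X F))[[k + m]]) v := by
    have e : ∀ a, τ a = ∑ᶠ i, t1 a (k + m - 1 - a) i + ∑ᶠ i, t2 a (k + m - 1 - a) i := fun a =>
      finsum_add_distrib (h1fin _ _) (h2fin _ _)
    simp only [e]
    rw [finsum_add_distrib (support_finsum_finite j1) (support_finsum_finite j2),
      finsum_comm_of_finite (f := fun a i => t1 a (k + m - 1 - a) i) j1,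
      finsum_comm_of_finite (f := fun a i => t2 a (k + m - 1 - a) i) j2, ncoeff_prod_zero']
    congr 1
    · refine finsum_congr fun i => ?_
      rw [ncoeff_mul_left hXF, ← finsum_comp_equiv (Equiv.subRight (i : ℤ)),
        map_finsum _ (mul_support_finite_left hXF (k + m + i - 1) v)]
      refine finsum_congr fun a => ?_
      rw [ht1, Equiv.subRight_apply]
      dsimp only
      rw [show k + m - 1 - (a - (i : ℤ)) = k + m + i - 1 - a by ring, sub_add_cancel]
    · refine finsum_congr fun i => ?_
      rw [ncoeff_mul_left hXF, ← finsum_comp_equiv (Equiv.addRight (1 + (i : ℤ)))]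
      refine finsum_congr fun a => ?_
      rw [ht2, Equiv.coe_addRight]
      dsimp only
      rw [show k + m - 1 - (a + (1 + (i : ℤ))) = k + m - 1 - i - 1 - a by ring,
        show a + (1 + (i : ℤ)) - 1 - i = a by ring]
  have r1 : (Function.support fun j : ℕ => ∑ᶠ i : ℕ, x (m - 2 - (j + i : ℕ))).Finite := by
    obtain ⟨N, hN⟩ := (hxneg (m - 2)).bddAbove
    refine support_finite_of_bound (N + 1) fun j hj => ?_
    refine (finsum_congr fun i => ?_).trans finsum_zero
    by_contra h
    have := hN h
    omega
  have r2 : (Function.support fun j : ℕ => ∑ᶠ i : ℕ, x (m + (j + i : ℕ))).Finite := by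
    obtain ⟨N, hN⟩ := (hxpos m).bddAbove
    refine support_finite_of_bound (N + 1) fun j hj => ?_
    refine (finsum_congr fun i => ?_).trans finsum_zero
    by_contra h
    have := hN h
    omega
  have hxs : (Function.support fun a : ℤ => ((m : ℂ) - 1 - a) • x a).Finite :=
    hxfin.subset fun a ha h => ha (by simp only [h, smul_zero])
  rw [ncoeff_prod_zero']
  simp only [ncoeff_shift, hJF, hFJ]
  have e1 : ∀ j : ℕ, ∑ᶠ i, (t1 (m - 1 - j) (k + j) i + t2 (m - 1 - j) (k + j) i) =
      τ (m - 1 - j) := fun j => by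
    rw [hτ]
    dsimp only
    rw [show k + m - 1 - (m - 1 - (j : ℤ)) = k + j by ring]
  have e2 : ∀ j : ℕ, ∑ᶠ i, (t1 (m + j) (k - 1 - j) i + t2 (m + j) (k - 1 - j) i) =
      τ (m + j) := fun j => by
    rw [hτ]
    dsimp only
    rw [show k + m - 1 - (m + (j : ℤ)) = k - 1 - j by ring]
  simp only [e1, e2]
  -- The multiplicity `l + 1` equals `m - 1 - a` at `a = m - 2 - l` and `-(m - 1 - a)` at `a = m +
  -- l`. The weighted sum is therefore split at `m - 1`, where its weight vanishes.
  rw [finsum_sub_distrib hτneg r1, finsum_add_distrib hτpos r2,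
    finsum_finsum_add (f := fun l : ℕ => x (m - 2 - l)) (hxneg _),
    finsum_finsum_add (f := fun l : ℕ => x (m + l)) (hxpos _), ← hτsum,
    finsum_int_split hτfin m, finsum_int_split hxs (m - 1),
    finsum_nat_succ (f := fun j : ℕ => ((m : ℂ) - 1 - ((m - 1 + j : ℤ) : ℂ)) • x (m - 1 + j))]
  · have e3 : ((m : ℂ) - 1 - ((m - 1 + (0 : ℕ) : ℤ) : ℂ)) • x (m - 1 + (0 : ℕ)) = 0 := by
      push_cast
      rw [add_zero, sub_self, zero_smul]
    have e4 : ∑ᶠ j : ℕ, ((m : ℂ) - 1 - ((m - 1 + (j + 1 : ℕ) : ℤ) : ℂ)) •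
        x (m - 1 + (j + 1 : ℕ)) = -∑ᶠ l : ℕ, (l + 1) • x (m + l) := by
      rw [← finsum_neg_distrib]
      refine finsum_congr fun j => ?_
      rw [← Nat.cast_smul_eq_nsmul ℂ, ← neg_smul,
        show m - 1 + ((j + 1 : ℕ) : ℤ) = m + j by push_cast; ring]
      congr 1
      push_cast
      ring
    have e5 : ∑ᶠ j : ℕ, ((m : ℂ) - 1 - ((m - 1 - 1 - j : ℤ) : ℂ)) • x (m - 1 - 1 - j) =
        ∑ᶠ l : ℕ, (l + 1) • x (m - 2 - l) := by
      refine finsum_congr fun j => ?_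
      rw [← Nat.cast_smul_eq_nsmul ℂ, show m - 1 - 1 - (j : ℤ) = m - 2 - j by ring]
      congr 1
      push_cast
      ring
    rw [e3, e4, e5]
    abel
  · exact hxs.preimage (f := fun j : ℕ => m - 1 + (j : ℤ)) fun a _ b _ h => by simpa using h

/-! ### One pair of symplectic bosons -/

/-- `[d, A(z)] = A'(z)`. -/
def Bracket (d : Module.End ℂ V) (A A' : VertexOperator ℂ V) : Prop :=
  ∀ m v, d ((A[[m]]) v) = (A[[m]]) (d v) + (A'[[m]]) v

theorem Bracket.prod {d : Module.End ℂ V} {A A' B B' : VertexOperator ℂ V} (hA : Bracket d A A')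
    (hB : Bracket d B B') (p : ℤ) :
    Bracket d (prod p A B) (ChiralField.prod p A' B + ChiralField.prod p A B') :=
  resProd_derivation hA hB (p - 1)

theorem Bracket.add {d : Module.End ℂ V} {A A' B B' : VertexOperator ℂ V} (hA : Bracket d A A')
    (hB : Bracket d B B') : Bracket d (A + B) (A' + B') := fun m v => by
  simp only [ncoeff_add, LinearMap.add_apply, map_add, hA m v, hB m v]
  abel

theorem Bracket.smul {d : Module.End ℂ V} {A A' : VertexOperator ℂ V} (hA : Bracket d A A')
    (c : ℂ) : Bracket d (c • A) (c • A') := fun m v => by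
  simp only [ncoeff_smul, LinearMap.smul_apply, map_smul, hA m v, smul_add]

theorem Bracket.der {d : Module.End ℂ V} {A A' : VertexOperator ℂ V} (hA : Bracket d A A') :
    Bracket d (der A) (ChiralField.der A') := fun m v => by
  simp only [ncoeff_der, LinearMap.smul_apply, map_smul, hA _ v, smul_add]

theorem Bracket.of_comm {A B : VertexOperator ℂ V} (h : Comm A B) (m : ℤ) :
    Bracket (A[[m]]) B 0 := fun k v => by
  rw [h.ncoeff, map_zero, Pi.zero_apply, LinearMap.zero_apply, add_zero]

theorem prod_zero_left (p : ℤ) (A : VertexOperator ℂ V) : prod p 0 A = 0 := by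
  rw [← zero_smul ℂ A, prod, resProd_smul_left, zero_smul, zero_smul]

theorem prod_zero_right (p : ℤ) (A : VertexOperator ℂ V) : prod p A 0 = 0 := by
  rw [← zero_smul ℂ A, prod, resProd_smul_right, zero_smul, zero_smul]

theorem prod_add_left (p : ℤ) (A B C : VertexOperator ℂ V) :
    prod p (A + B) C = prod p A C + prod p B C := resProd_add_left A B C _

theorem prod_smul_left (p : ℤ) (c : ℂ) (A B : VertexOperator ℂ V) :
    prod p (c • A) B = c • prod p A B := resProd_smul_left c A B _

theorem prod_add_right (p : ℤ) (A B C : VertexOperator ℂ V) :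
    prod p A (B + C) = prod p A B + prod p A C := resProd_add_right A B C _

theorem prod_smul_right (p : ℤ) (c : ℂ) (A B : VertexOperator ℂ V) :
    prod p A (c • B) = c • prod p A B := resProd_smul_right c A B _

theorem prod_shift_right (p : ℤ) (A B : VertexOperator ℂ V) (g : ℤ) :
    prod p A (shift g B) = shift g (prod p A B) := resProd_shift_right A B g _

/-- A pair of fields with `X(z) Y(w) ∼ 1 / (z - w)`. -/
structure BosonPair (X Y : VertexOperator ℂ V) : Prop where
  comm_left : Comm X X
  comm_right : Comm Y Y
  bracket : ∀ m, Bracket (X[[m]]) Y (shift m (one V))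

/-- The field `D X` for a pair `X, Y` of symplectic bosons. -/
def bosonD (X Y : VertexOperator ℂ V) : VertexOperator ℂ V :=
  prod 0 (-prod 0 X Y) X + prod 0 X (prod 0 Y X) + prod 0 (-prod 0 X Y) X

namespace BosonPair

variable {X Y : VertexOperator ℂ V} (h : BosonPair X Y)

include h

theorem bracket_apply (m k : ℤ) (v : V) :
    (X[[m]]) ((Y[[k]]) v) = (Y[[k]]) ((X[[m]]) v) + if m + k = -1 then v else 0 := by
  rw [h.bracket m k v, ncoeff_shift, ncoeff_one, add_comm k]
  congr 1
  split_ifs <;> rfl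

theorem left_comm (F : VertexOperator ℂ V) : prod 0 X (prod 0 Y F) = prod 0 Y (prod 0 X F) :=
  prod_zero_left_comm (fun i j v => by rw [h.bracket_apply, if_neg (by omega), add_zero])
    (fun i j v => by rw [h.bracket_apply, if_neg (by omega), add_zero]) F

theorem prod_comm : prod 0 X Y = prod 0 Y X := by
  have := h.left_comm (one V)
  rwa [prod_zero_one, prod_zero_one] at this

theorem comm_sq : Comm X (mul X X) := h.comm_left.mul_right h.comm_left h.comm_left

theorem bracket_left (m : ℤ) : Bracket (Y[[m]]) X ((-1 : ℂ) • shift m (one V)) := fun k v => by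
  rw [h.bracket_apply, ncoeff_smul, LinearMap.smul_apply, ncoeff_shift, ncoeff_one]
  split_ifs <;> simp

theorem bracket_sq (m : ℤ) : Bracket (Y[[m]]) (mul X X) ((-2 : ℂ) • shift m X) := by
  have := (h.bracket_left m).prod (h.bracket_left m) 0
  rw [prod_zero_eq_mul h.comm_left, prod_smul_left, prod_smul_right, prod_zero_shift_one,
    prod_zero_shift_one_left, ← add_smul, ← neg_add, one_add_one_eq_two] at this
  exact this

/-- Regrouping costs one contraction of `Y` with the outer `X`; with `G = 1` only one summand of the
correction survives, and it is the mode of `∂X`. -/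
theorem prod_current_left : prod 0 (prod 0 Y X) X = prod 0 Y (mul X X) - der X := by
  refine vo_ext fun k v => ?_
  have := ncoeff_prod_zero_shift (Y := Y) (G := one V) h.comm_left (comm_one X) (fun k m v => by
    rw [h.bracket_left k m v, ncoeff_smul, LinearMap.smul_apply, ncoeff_shift, neg_one_smul,
      sub_eq_add_neg]) 0 k v
  rw [shift_zero, finsum_eq_single _ (k - 1)] at this
  · rw [this, ncoeff_sub, LinearMap.sub_apply, ncoeff_der, ncoeff_one, if_pos (by ring),
      LinearMap.smul_apply, Module.End.one_apply, add_zero]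
    congr 2
    push_cast
    ring
  · intro a ha
    rw [ncoeff_one, if_neg (by omega), LinearMap.zero_apply, map_zero, smul_zero]

/-- The regrouping formula with `F = X²` and `G = 2X`. The shift keeps the scalar `w^m` inside the
current, as required for `comm_bosonD`. -/
theorem ncoeff_prod_current_sq (m k : ℤ) (v : V) :
    ((prod 0 (shift m (prod 0 Y X)) (mul X X))[[k]]) v =
      ((prod 0 Y (mul X (mul X X)))[[k + m]]) v - ((m : ℂ) - k) • ((mul X X)[[k + m - 1]]) v := by
  rw [ncoeff_prod_zero_shift (G := (2 : ℂ) • X) h.comm_sq (h.comm_left.smul_right 2)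
    fun k m v => ?_]
  · congr 1
    set x : ℤ → V := fun a => (X[[a]]) ((X[[m + k - 2 - a]]) v) with hx
    have hfin : (Function.support x).Finite := mul_support_finite_left h.comm_left (m + k - 2) v
    have hs : ∀ c : ℤ → ℂ, (Function.support fun a => c a • x a).Finite := fun c =>
      hfin.subset fun a ha h => ha (by simp only [h, smul_zero])
    have hW : ((mul X X)[[k + m - 1]]) v = ∑ᶠ a, x a := by
      rw [ncoeff_mul_left h.comm_left]
      exact finsum_congr fun a => by
        rw [hx, show k + m - 1 - 1 - a = m + k - 2 - a by ring]
    -- The reflection `a ↦ m + k - 2 - a` preserves `x`, since the modes of `X` commute. The weight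
    -- `m - 1 - a` and its reflection add up to the constant `m - k`, and the factor `2` in `G`
    -- supplies both copies.
    have hsym : ∑ᶠ a : ℤ, ((m : ℂ) - 1 - a) • x a =
        ∑ᶠ a : ℤ, ((m : ℂ) - 1 - (m + k - 2 - a)) • x a := by
      rw [← finsum_comp_equiv (Equiv.subLeft (m + k - 2))]
      refine finsum_congr fun a => ?_
      rw [Equiv.subLeft_apply, hx]
      dsimp only
      rw [sub_sub_cancel, h.comm_left.ncoeff]
      push_cast
      rfl
    have hG : ∑ᶠ a : ℤ, ((m : ℂ) - 1 - a) • (X[[a]]) ((((2 : ℂ) • X)[[m + k - 2 - a]]) v) =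
        ∑ᶠ a : ℤ, ((m : ℂ) - 1 - a) • x a + ∑ᶠ a : ℤ, ((m : ℂ) - 1 - a) • x a := by
      rw [← finsum_add_distrib (hs _) (hs _)]
      refine finsum_congr fun a => ?_
      rw [ncoeff_smul, LinearMap.smul_apply, map_smul, two_smul, smul_add]
    rw [hG]
    nth_rw 2 [hsym]
    rw [← finsum_add_distrib (hs _) (hs _), hW, smul_finsum' _ hfin]
    refine finsum_congr fun a => ?_
    rw [← add_smul]
    congr 1
    ring
  · rw [h.bracket_sq k m v, ncoeff_smul, ncoeff_smul, LinearMap.smul_apply, LinearMap.smul_apply,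
      ncoeff_shift, neg_smul, sub_eq_add_neg]

/-- Each of the two terms `(𝒜 X)_0` equals `-(Y X²)_0 + ∂X`, and `(X (Y X)_0)_0 = (Y X²)_0` cancels
one of the quadratic parts. -/
theorem bosonD_eq : bosonD X Y = (-1 : ℂ) • prod 0 Y (mul X X) + (2 : ℂ) • der X := by
  have e : prod 0 (-prod 0 X Y) X = -(prod 0 Y (mul X X) - der X) := by
    rw [h.prod_comm, ← h.prod_current_left]
    exact resProd_neg_left _ _ _
  rw [bosonD, e, h.left_comm, prod_zero_eq_mul h.comm_left, two_smul]
  have e' : (-1 : ℂ) • prod 0 Y (mul X X) = -prod 0 Y (mul X X) :=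
    neg_one_smul ℂ (prod 0 Y (mul X X))
  rw [e']
  abel

/-- A commutator with a mode is a derivation of normally ordered products, and `X_m` sees only the
factor `Y`, which it replaces by the scalar `w^m`. -/
theorem bracket_left_bosonD (m : ℤ) :
    Bracket (X[[m]]) (bosonD X Y) ((-1 : ℂ) • shift m (mul X X)) := by
  have := (((h.bracket m).prod (Bracket.of_comm h.comm_sq m) 0).smul (-1)).add
    ((Bracket.of_comm h.comm_left m).der.smul 2)
  rw [← h.bosonD_eq, prod_zero_shift_one_left, prod_zero_right, add_zero] at this
  intro k v
  rw [this k v, ncoeff_add, LinearMap.add_apply, ncoeff_smul 2, ncoeff_der, map_zero]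
  simp

/-- `D X (z) X(w) ∼ X(w)² / (z - w)`. -/
theorem bracket_bosonD_left (m : ℤ) : Bracket ((bosonD X Y)[[m]]) X (shift m (mul X X)) :=
  fun k v => by
    rw [h.bracket_left_bosonD k m v, ncoeff_smul, LinearMap.smul_apply, ncoeff_shift, ncoeff_shift,
      neg_one_smul, add_comm k m, neg_add_cancel_right]

/-- Computed from the other side: the derivation `[Y_k, ·]` is known on both constituents of `DX`,
and its value on the mode `m` of `DX` is reread as a field in the index `k`. -/
theorem bracket_bosonD_right (m : ℤ) : Bracket ((bosonD X Y)[[m]]) Y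
    ((-2 : ℂ) • shift m (prod 0 Y X) + (-2 * (m : ℂ)) • shift (m - 1) (one V)) := fun k v => by
  have := (((Bracket.of_comm h.comm_right k).prod (h.bracket_sq k) 0).smul (-1)).add
    ((h.bracket_left k).der.smul 2)
  rw [← h.bosonD_eq, prod_zero_left, zero_add, prod_smul_right, prod_shift_right] at this
  rw [this m v]
  simp only [ncoeff_add, ncoeff_smul, ncoeff_der, LinearMap.add_apply, LinearMap.smul_apply,
    ncoeff_shift, smul_smul]
  rw [show m - 1 + k = k + (m - 1) by ring, add_comm m k]
  module

/-- Apply the derivation `[DX_m, ·]` to `-(Y X²)_0 + 2∂X`. The terms in `Y X³` cancel. The terms in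
the mode `k + m - 1` of `X²` have coefficients `-2(m-k)` from regrouping, `2m` from the double pole
with `Y`, and `-2k` from the derivative, with sum zero. -/
theorem comm_bosonD : Comm (bosonD X Y) (bosonD X Y) := by
  refine comm_iff.2 fun m k v => ?_
  have hX := h.bracket_bosonD_left m
  have hW := hX.prod hX 0
  rw [prod_zero_eq_mul h.comm_left, prod_zero_eq_mul (h.comm_sq.shift_right m),
    prod_zero_eq_mul (h.comm_sq.shift_right m).symm,
    mul_comm_of_comm (h.comm_sq.shift_right m).symm, mul_shift_right h.comm_sq] at hW
  have := ((((h.bracket_bosonD_right m).prod hW 0).smul (-1)).add (hX.der.smul 2)) k v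
  rw [← h.bosonD_eq] at this
  rw [this]
  simp only [prod_add_left, prod_add_right, prod_smul_left, prod_shift_right,
    prod_zero_shift_one_left, ncoeff_add, ncoeff_smul, ncoeff_der, LinearMap.add_apply,
    LinearMap.smul_apply, ncoeff_shift, h.ncoeff_prod_current_sq]
  rw [show k - 1 + m = k + m - 1 by ring, show k + (m - 1) = k + m - 1 by ring]
  module

end BosonPair

/-! ### Products of commuting families -/

section ListMul

variable {Γ Γ' ι : Type*} [AddCommGroup Γ] [PartialOrder Γ] [IsOrderedCancelAddMonoid Γ]
  [PartialOrder Γ']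

/-- The product of a list of commuting vertex operators. -/
def listMul (base : HVertexOperator Γ ℂ V V) (f : ι → HVertexOperator Γ ℂ V V) (l : List ι) :
    HVertexOperator Γ ℂ V V :=
  l.foldr (fun i B => mul (f i) B) base

theorem listMul_cons (base : HVertexOperator Γ ℂ V V) (f : ι → HVertexOperator Γ ℂ V V) (i : ι)
    (l : List ι) : listMul base f (i :: l) = mul (f i) (listMul base f l) := rfl

/-- A family of pairwise commuting vertex operators that also commute with `base`. -/
structure CommFamily (base : HVertexOperator Γ ℂ V V) (f : ι → HVertexOperator Γ ℂ V V) :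
    Prop where
  comm : ∀ i j, i ≠ j → Comm (f i) (f j)
  base : ∀ i, Comm (f i) base

theorem listMul_congr {base : HVertexOperator Γ ℂ V V} {f g : ι → HVertexOperator Γ ℂ V V}
    {l : List ι} (h : ∀ i ∈ l, f i = g i) : listMul base f l = listMul base g l := by
  induction l with
  | nil => rfl
  | cons i l ih =>
    rw [listMul_cons, listMul_cons, h i List.mem_cons_self,
      ih fun j hj => h j (List.mem_cons_of_mem i hj)]

theorem CommFamily.comm_tail {base : HVertexOperator Γ ℂ V V}
    {f : ι → HVertexOperator Γ ℂ V V} (hf : CommFamily base f) {i : ι} {l : List ι}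
    (hl : (i :: l).Nodup) : Comm (f i) (listMul base f l) := by
  induction l generalizing i with
  | nil => exact hf.base i
  | cons j l ih =>
    have h1 := List.nodup_cons.1 hl
    exact (ih h1.2).mul_right (hf.comm i j fun h => h1.1 (h ▸ List.mem_cons_self))
      (ih (List.nodup_cons.2 ⟨fun h => h1.1 (List.mem_cons_of_mem j h),
        (List.nodup_cons.1 h1.2).2⟩))

theorem CommFamily.comm_listMul {base : HVertexOperator Γ ℂ V V}
    {f : ι → HVertexOperator Γ ℂ V V} (hf : CommFamily base f) {l : List ι} (hl : l.Nodup)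
    {A : HVertexOperator Γ' ℂ V V} (hA : ∀ i ∈ l, Comm A (f i)) (hb : Comm A base) :
    Comm A (listMul base f l) := by
  induction l with
  | nil => exact hb
  | cons i l ih =>
    exact (hf.comm_tail hl).mul_right (hA i List.mem_cons_self)
      (ih (List.nodup_cons.1 hl).2 fun j hj => hA j (List.mem_cons_of_mem i hj))

end ListMul

theorem comp_listMul {ι : Type*} {E E' : ι → VertexOperator ℂ V}
    (hE : CommFamily (one V) E) (hE' : CommFamily (one V) E')
    (hEE' : ∀ i j, i ≠ j → Comm (E i) (E' j)) {l : List ι} (hl : l.Nodup) :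
    comp (listMul (one V) E l) (listMul (one V) E' l) =
      listMul (comp (one V) (one V)) (fun i => comp (E i) (E' i)) l := by
  induction l with
  | nil => rfl
  | cons i l ih =>
    have hl' := List.nodup_cons.1 hl
    have hne : ∀ j ∈ l, i ≠ j := fun j hj h => hl'.1 (h ▸ hj)
    rw [listMul_cons, listMul_cons, listMul_cons, ← ih hl'.2]
    exact comp_mul (hE.comm_tail hl)
      (hE'.comm_listMul hl'.2 (fun j hj => hEE' i j (hne j hj)) (comm_one _))
      (hE.comm_listMul hl'.2 (fun j hj => (hEE' j i (hne j hj).symm).symm) (comm_one _))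
      (hE'.comm_tail hl)

/-! ### Division by the difference of the variables -/

theorem mulDiff_mul_left {A B : HVertexOperator (ℤ ×ₗ ℤ) ℂ V V} (h : Comm A B) :
    mulDiff (mul A B) = mul (mulDiff A) B := by
  have e : mulDiff A = shift (toLex (0, 1)) A + (-1 : ℂ) • shift (toLex (1, 0)) A := by
    rw [mulDiff, sub_eq_add_neg]
    congr 1
    exact (neg_one_smul ℂ (shift (toLex ((1 : ℤ), (0 : ℤ))) A)).symm
  have hs := (h.symm.shift_right (toLex (1, 0))).symm
  rw [e, mul_add_left (h.symm.shift_right _).symm (hs.symm.smul_right _).symm, mul_smul_left hs,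
    mul_shift_left h, mul_shift_left h, mulDiff, sub_eq_add_neg]
  congr 1
  exact (neg_one_smul ℂ (shift (toLex ((1 : ℤ), (0 : ℤ))) (mul A B))).symm

theorem Comm.mulDiff_right {Γ : Type*} [PartialOrder Γ] {A : HVertexOperator Γ ℂ V V}
    {B : HVertexOperator (ℤ ×ₗ ℤ) ℂ V V} (h : Comm A B) : Comm A (mulDiff B) :=
  (h.shift_right _).sub_right (h.shift_right _)

theorem mulDiff_mul_right {A B : HVertexOperator (ℤ ×ₗ ℤ) ℂ V V} (h : Comm A B) :
    mulDiff (mul A B) = mul A (mulDiff B) := by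
  rw [mul_comm_of_comm h, mulDiff_mul_left h.symm, mul_comm_of_comm h.mulDiff_right]

/-- The scalar `z - w` may be absorbed into any single factor, so a relation for the factor `i`
passes to the whole product. -/
theorem mulDiff_listMul {ι : Type*} {base : HVertexOperator (ℤ ×ₗ ℤ) ℂ V V}
    {f g h : ι → HVertexOperator (ℤ ×ₗ ℤ) ℂ V V} (hf : CommFamily base f)
    (hg : CommFamily base g) (hh : CommFamily base h) {i : ι} {c : ℂ}
    (hi : mulDiff (f i) = c • g i + mulDiff (h i)) (hfg : ∀ j, j ≠ i → f j = g j)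
    (hfh : ∀ j, j ≠ i → f j = h j) {l : List ι} (hl : l.Nodup) (hil : i ∈ l) :
    mulDiff (listMul base f l) = c • listMul base g l + mulDiff (listMul base h l) := by
  induction l with
  | nil => exact absurd hil List.not_mem_nil
  | cons j l ih =>
    have hl' := List.nodup_cons.1 hl
    simp only [listMul_cons]
    have cf := hf.comm_tail hl
    have cg := hg.comm_tail hl
    have ch := hh.comm_tail hl
    rcases List.mem_cons.1 hil with rfl | hil
    · have eg : listMul base f l = listMul base g l :=
        listMul_congr fun j hj => hfg j fun h => hl'.1 (h ▸ hj)
      have eh : listMul base f l = listMul base h l :=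
        listMul_congr fun j hj => hfh j fun h => hl'.1 (h ▸ hj)
      rw [← eg] at cg
      rw [← eh] at ch
      rw [← eg, ← eh, mulDiff_mul_left cf, hi, mulDiff_mul_left ch,
        mul_add_left (cg.symm.smul_right c).symm ch.symm.mulDiff_right.symm, mul_smul_left cg]
    · have hne : j ≠ i := fun h => hl'.1 (h ▸ hil)
      rw [← hfg j hne] at cg
      rw [← hfh j hne] at ch
      rw [mulDiff_mul_right cf, ih hl'.2 hil, ← hfg j hne, ← hfh j hne, mulDiff_mul_right ch,
        mul_add_right (cg.smul_right c) ch.mulDiff_right, mul_smul_right cg]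

/-- The expansion of `1 / (z - w)` in the domain `|z| > |w|`, where the first variable is `w`. -/
def invDiff (V : Type*) [AddCommGroup V] [Module ℂ V] : HVertexOperator (ℤ ×ₗ ℤ) ℂ V V :=
  of_coeff (fun a => if 0 ≤ (ofLex a).1 ∧ (ofLex a).2 = -1 - (ofLex a).1 then 1 else 0)
    fun v => by
      have hm : Monotone fun j : ℕ => (toLex ((j : ℤ), -1 - (j : ℤ)) : ℤ ×ₗ ℤ) := fun i j hij => by
        rcases hij.eq_or_lt with rfl | h
        · exact le_rfl
        · exact (Prod.Lex.toLex_lt_toLex.2 (Or.inl (Int.ofNat_lt.2 h))).le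
      refine ((Set.IsWF.of_wellFoundedLT (Set.univ : Set ℕ)).isPWO.image_of_monotone
        hm).mono fun a ha => ?_
      rw [Function.mem_support] at ha
      by_cases h : 0 ≤ (ofLex a).1 ∧ (ofLex a).2 = -1 - (ofLex a).1
      · refine ⟨(ofLex a).1.toNat, trivial, ?_⟩
        dsimp only
        rw [Int.toNat_of_nonneg h.1, ← h.2]
        rfl
      · rw [if_neg h] at ha
        exact absurd rfl ha

theorem coeff_invDiff (a : ℤ ×ₗ ℤ) : (invDiff V).coeff a =
    if 0 ≤ (ofLex a).1 ∧ (ofLex a).2 = -1 - (ofLex a).1 then 1 else 0 := rfl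

theorem comm_invDiff {Γ : Type*} [PartialOrder Γ] (A : HVertexOperator Γ ℂ V V) :
    Comm A (invDiff V) := fun a b v => by
  rw [coeff_invDiff]
  split_ifs
  · rfl
  · exact map_zero _

/-- The geometric series telescopes to the constant `1`. When the first variable is `z`, the same
series stands for `1/(w-z)`, and contractions in that ordering carry the opposite sign. -/
theorem mulDiff_invDiff_mul (A : HVertexOperator (ℤ ×ₗ ℤ) ℂ V V) :
    mulDiff (mul (invDiff V) A) = A := by
  have hd : ∀ a v, (mulDiff (invDiff V)).coeff a v = if a = 0 then v else 0 := fun a v => by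
    rw [mulDiff, map_sub, Pi.sub_apply, LinearMap.sub_apply, coeff_shift, coeff_shift,
      coeff_invDiff, coeff_invDiff, ofLex_sub, ofLex_sub, ofLex_toLex, ofLex_toLex]
    have ha : a = 0 ↔ ((ofLex a).1 = 0 ∧ (ofLex a).2 = 0) := Prod.ext_iff
    simp only [ha, Prod.fst_sub, Prod.snd_sub, sub_zero]
    split_ifs <;> first | omega | simp
  rw [mulDiff_mul_left (comm_invDiff A).symm]
  refine hv_ext fun a v => ?_
  rw [coeff_mul (comm_invDiff A).mulDiff_right.symm, finsum_eq_single _ 0]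
  · rw [hd, if_pos rfl, sub_zero]
  · intro b hb
    rw [hd, if_neg hb]

theorem mode2_invDiff_mul (A : HVertexOperator (ℤ ×ₗ ℤ) ℂ V V) (p q : ℤ) (v : V) :
    mode2 (mul (invDiff V) A) p q v = ∑ᶠ j : ℕ, mode2 A (p + j) (q - 1 - j) v := by
  have hinj : Function.Injective fun j : ℕ => (toLex ((j : ℤ), -1 - (j : ℤ)) : ℤ ×ₗ ℤ) :=
    fun i j h => by
      have := congrArg (fun a : ℤ ×ₗ ℤ => (ofLex a).1) h
      simpa using this
  rw [mode2, coeff_mul (comm_invDiff A).symm]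
  have h0 : ∀ a ∉ Set.range fun j : ℕ => (toLex ((j : ℤ), -1 - (j : ℤ)) : ℤ ×ₗ ℤ),
      (invDiff V).coeff a = 0 := fun a ha => by
    rw [coeff_invDiff, if_neg]
    rintro ⟨h1, h2⟩
    refine ha ⟨(ofLex a).1.toNat, ?_⟩
    dsimp only
    rw [Int.toNat_of_nonneg h1, ← h2]
    rfl
  rw [← finsum_mem_univ, ← finsum_mem_inter_support_eq' _ (Set.range fun j : ℕ =>
    (toLex ((j : ℤ), -1 - (j : ℤ)) : ℤ ×ₗ ℤ)) Set.univ, finsum_mem_range hinj]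
  · refine finsum_congr fun j => ?_
    rw [coeff_invDiff, if_pos ⟨by simp, by simp⟩, Module.End.one_apply, mode2, ← toLex_sub,
      Prod.mk_sub_mk, show -p - 1 - (j : ℤ) = -(p + j) - 1 by ring,
      show -q - 1 - (-1 - (j : ℤ)) = -(q - 1 - j) - 1 by ring]
  · intro a ha
    refine ⟨fun _ => trivial, fun _ => ?_⟩
    by_contra h
    exact ha (by dsimp only; rw [h0 a h, LinearMap.zero_apply])

/-! ### Regular pairs and locality -/

/-- The difference of the two radial orderings, as a function of the two modes. -/
def modeDiff (U W : HVertexOperator (ℤ ×ₗ ℤ) ℂ V V) (v : V) (m k : ℤ) : V :=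
  mode2 U k m v - mode2 W m k v

/-- Multiplication by `z - w` of a formal distribution given by its modes. -/
def diffOp {V : Type*} [AddCommGroup V] (c : ℤ → ℤ → V) (m k : ℤ) : V := c (m + 1) k - c m (k + 1)

/-- The variables of `W` are in the opposite order, so the minus sign makes both terms be multiplied
by the same `z - w`. -/
theorem modeDiff_mulDiff (U W : HVertexOperator (ℤ ×ₗ ℤ) ℂ V V) (v : V) :
    modeDiff (mulDiff U) (-mulDiff W) v = diffOp (modeDiff U W v) := by
  funext m k
  have hn : mode2 (-mulDiff W) m k = -mode2 (mulDiff W) m k := by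
    rw [mode2, map_neg]; rfl
  rw [modeDiff, diffOp, modeDiff, modeDiff, hn, mode2_mulDiff, mode2_mulDiff]
  simp only [LinearMap.sub_apply, LinearMap.neg_apply]
  abel

theorem resOut_zero (U : HVertexOperator (ℤ ×ₗ ℤ) ℂ V V) (k : ℤ) (v : V) :
    resOut 0 U k v = mode2 U k 0 v := by
  rw [resOut, finsum_eq_single _ 0]
  · simp [signedChoose_zero]
  · intro j hj
    rw [signedChoose, Ring.choose_zero_pos _ (Nat.pos_of_ne_zero hj), Int.cast_zero, mul_zero,
      zero_smul]

theorem resIn_zero (W : HVertexOperator (ℤ ×ₗ ℤ) ℂ V V) (k : ℤ) (v : V) :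
    resIn 0 W k v = mode2 W 0 k v := by
  rw [resIn, finsum_eq_single _ 0]
  · simp [signedChoose_zero]
  · intro j hj
    rw [signedChoose, Ring.choose_zero_pos _ (Nat.pos_of_ne_zero hj), Int.cast_zero, mul_zero,
      zero_smul]

theorem resIn_neg (r : ℤ) (W : HVertexOperator (ℤ ×ₗ ℤ) ℂ V V) (k : ℤ) (v : V) :
    resIn r (-W) k v = -resIn r W k v := by
  have := resIn_smul r (-1) W k v
  rw [neg_one_smul ℂ (resIn r W k v)] at this
  rw [← this]
  congr 1
  exact (neg_one_smul ℂ W).symm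

/-- For `r ≥ 0` the factor `(z-w)^r` is a polynomial and can be absorbed into the operators, leaving
the plain residue in `z`, which is the mode `0`. -/
theorem resOut_sub_resIn (U W : HVertexOperator (ℤ ×ₗ ℤ) ℂ V V) (r : ℕ) (k : ℤ) (v : V) :
    resOut r U k v - resIn r W k v = (diffOp^[r] (modeDiff U W v)) 0 k := by
  induction r generalizing U W with
  | zero => rw [Nat.cast_zero, resOut_zero, resIn_zero]; rfl
  | succ r ih =>
    rw [Function.iterate_succ_apply, ← modeDiff_mulDiff, ← ih, resOut_mulDiff, resIn_neg,
      resIn_mulDiff, neg_neg, Nat.cast_succ]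

theorem diffOp_iterate_zero {V : Type*} [AddCommGroup V] (N : ℕ) : diffOp^[N] (0 : ℤ → ℤ → V) = 0 :=
  Function.iterate_fixed (by funext m k; exact sub_zero _) N

/-- A distribution killed by `(z-w)^N` is a combination of derivatives of `δ(z-w)` with its residues
as coefficients. In the induction the proposed sum `e` and `c` agree after multiplication by `z -
w`, by Pascal's rule, and on the row `m = 0`; the recursion in `m`, run in both directions, forces
equality. -/
theorem eq_sum_of_diffOp_iterate_eq_zero {N : ℕ} {c : ℤ → ℤ → V} (h : diffOp^[N] c = 0)
    (m k : ℤ) : c m k = ∑ p ∈ Finset.range N,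
      ((Ring.choose m p : ℤ) : ℂ) • (diffOp^[p] c) 0 (m + k - p) := by
  induction N generalizing c m k with
  | zero => rw [Finset.sum_range_zero]; exact congrFun (congrFun h m) k
  | succ N ih =>
    rw [Function.iterate_succ_apply] at h
    set e : ℤ → ℤ → V := fun m k => ∑ p ∈ Finset.range (N + 1),
      ((Ring.choose m p : ℤ) : ℂ) • (diffOp^[p] c) 0 (m + k - p) with he
    have hstep : ∀ m k, e (m + 1) k - e m (k + 1) = c (m + 1) k - c m (k + 1) := fun m k => by
      refine Eq.trans ?_ (ih h m k).symm
      rw [he]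
      dsimp only
      rw [← Finset.sum_sub_distrib, Finset.sum_range_succ']
      simp only [Ring.choose_zero_right, Nat.cast_zero, sub_zero, Function.iterate_zero, id_eq]
      rw [add_right_comm m 1 k, ← add_assoc m k 1, sub_self, add_zero]
      refine Finset.sum_congr rfl fun p _ => ?_
      rw [← sub_smul, Ring.choose_succ_succ, Function.iterate_succ_apply]
      congr 1
      · push_cast; ring
      · push_cast; ring_nf
    have hzero : ∀ k, e 0 k = c 0 k := fun k => by
      rw [he]
      dsimp only
      rw [Finset.sum_range_succ', Finset.sum_eq_zero fun p _ => ?_]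
      · simp
      · rw [Ring.choose_zero_succ, Int.cast_zero, zero_smul]
    have hall : ∀ m k, e m k = c m k := fun m => by
      induction m using Int.induction_on with
      | zero => exact hzero
      | succ i hi =>
        intro k
        have := hstep i k
        rwa [hi, sub_left_inj] at this
      | pred i hi =>
        intro k
        have := hstep (-i - 1) (k - 1)
        rwa [sub_add_cancel, sub_add_cancel, hi, sub_right_inj] at this
    exact (hall m k).symm

/-- The operator product expansion of two mutually local fields. -/
theorem OPE_of_local {A B : VertexOperator ℂ V} {N : ℕ}
    (h : ∀ v, diffOp^[N] (modeDiff (comp A B) (comp B A) v) = 0) :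
    OPE A B N fun p => prod p A B := by
  intro m k
  refine LinearMap.ext fun v => ?_
  have := eq_sum_of_diffOp_iterate_eq_zero (h v) m k
  rw [LinearMap.sub_apply, Module.End.mul_apply, Module.End.mul_apply]
  refine Eq.trans this ?_
  rw [LinearMap.sum_apply]
  refine Finset.sum_nbij' (fun p => p + 1) (fun p => p - 1) (fun p hp => ?_) (fun p hp => ?_)
    (fun p hp => ?_) (fun p hp => ?_) fun p hp => ?_
  · rw [Finset.mem_range] at hp
    exact Finset.mem_Icc.2 ⟨by omega, by omega⟩
  · rw [Finset.mem_Icc] at hp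
    exact Finset.mem_range.2 (by omega)
  · exact Nat.add_sub_cancel p 1
  · rw [Finset.mem_Icc] at hp
    exact Nat.sub_add_cancel hp.1
  · dsimp only
    rw [LinearMap.smul_apply, prod, ncoeff_resProd_eq_sub, Nat.cast_succ, add_sub_cancel_right,
      resOut_sub_resIn, Nat.add_sub_cancel]

/-! ### Binomial identities -/

/-- The product of the two binomials factors as `(q+d choose q) (d choose i)` at `j = q + i`,
leaving the expansion of `(1-1)^d`. -/
theorem sum_neg_one_pow_choose_mul_choose (q d : ℕ) :
    ∑ j ∈ Finset.range (q + d + 1), (-1 : ℤ) ^ j * (q + d).choose j * j.choose q =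
      if d = 0 then (-1) ^ q else 0 := by
  rw [add_assoc, Finset.sum_range_add, Finset.sum_eq_zero fun j hj => ?_, zero_add]
  · have h : ∀ i ∈ Finset.range (d + 1),
        (-1 : ℤ) ^ (q + i) * (q + d).choose (q + i) * (q + i).choose q =
          (-1) ^ q * (q + d).choose q * ((-1) ^ i * d.choose i) := fun i hi => by
      have hi' : i ≤ d := Nat.lt_succ_iff.1 (Finset.mem_range.1 hi)
      have := Nat.choose_mul (n := q + d) (k := q + i) (s := q) (Nat.le_add_right q i)
      rw [Nat.add_sub_cancel_left, Nat.add_sub_cancel_left] at this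
      have h2 : ((q + d).choose (q + i) : ℤ) * (q + i).choose q =
          (q + d).choose q * d.choose i := by exact_mod_cast this
      rw [mul_assoc, h2, pow_add]
      ring
    rw [Finset.sum_congr rfl h, ← Finset.mul_sum, Int.alternating_sum_range_choose]
    split_ifs with hd
    · simp [hd]
    · simp
  · rw [Nat.choose_eq_zero_of_lt (Finset.mem_range.1 hj), Nat.cast_zero, mul_zero]

/-- By Pascal's rule, passing from `d` to `d + 1` subtracts the sum of the preceding lemma, which is
nonzero only at `d = 0`. -/
theorem sum_neg_one_pow_choose_succ_mul_choose (q d : ℕ) :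
    ∑ j ∈ Finset.range (q + d), (-1 : ℤ) ^ (j + 1) * (q + d).choose (j + 1) * j.choose q =
      if d = 0 then 0 else (-1) ^ (q + 1) := by
  induction d with
  | zero =>
    rw [if_pos rfl]
    refine Finset.sum_eq_zero fun j hj => ?_
    rw [Nat.choose_eq_zero_of_lt (show j < q from Finset.mem_range.1 hj), Nat.cast_zero, mul_zero]
  | succ d ih =>
    have h := sum_neg_one_pow_choose_mul_choose q d
    have e : ∑ j ∈ Finset.range (q + d + 1),
        (-1 : ℤ) ^ (j + 1) * (q + d).choose (j + 1) * j.choose q =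
        ∑ j ∈ Finset.range (q + d), (-1 : ℤ) ^ (j + 1) * (q + d).choose (j + 1) * j.choose q := by
      rw [Finset.sum_range_succ, Nat.choose_succ_self, Nat.cast_zero, mul_zero, zero_mul, add_zero]
    rw [if_neg (Nat.succ_ne_zero d), ← add_assoc]
    have e2 : ∑ j ∈ Finset.range (q + d + 1),
        (-1 : ℤ) ^ (j + 1) * (q + d + 1).choose (j + 1) * j.choose q =
        -∑ j ∈ Finset.range (q + d + 1), (-1 : ℤ) ^ j * (q + d).choose j * j.choose q +
        ∑ j ∈ Finset.range (q + d + 1),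
          (-1 : ℤ) ^ (j + 1) * (q + d).choose (j + 1) * j.choose q := by
      rw [← Finset.sum_neg_distrib, ← Finset.sum_add_distrib]
      refine Finset.sum_congr rfl fun j _ => ?_
      rw [Nat.choose_succ_succ, Nat.cast_add]
      ring
    rw [e2, e, ih, h]
    split_ifs <;> ring

/-- The coefficient of a summand obtained by contracting `k` of the factors. -/
def contractionCoeff (p k : ℕ) : ℂ :=
  if p ≤ k then (-1 : ℂ) ^ (k - p) * ((k - 1).choose (p - 1) : ℂ) else 0

/-- The condition that makes the inversion in `resolution_formula` work: a set of size `m ≥ p`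
receives total weight `1` from its subsets. -/
theorem sum_choose_mul_contractionCoeff {p m : ℕ} (hp : 1 ≤ p) (hm : p ≤ m) :
    ∑ k ∈ Finset.range (m + 1), m.choose k • contractionCoeff p k = 1 := by
  obtain ⟨q, rfl⟩ := Nat.exists_eq_add_of_le' hp
  obtain ⟨d, rfl⟩ := Nat.exists_eq_add_of_le hm
  have h := sum_neg_one_pow_choose_succ_mul_choose q (d + 1)
  rw [if_neg (Nat.succ_ne_zero d)] at h
  rw [Finset.sum_range_succ', contractionCoeff, if_neg (by omega), smul_zero, add_zero,
    show q + 1 + d = q + (d + 1) by ring]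
  have e : ∀ j : ℕ, (q + (d + 1)).choose (j + 1) • contractionCoeff (q + 1) (j + 1) =
      (-1 : ℂ) ^ (q + 1) *
        (((-1 : ℤ) ^ (j + 1) * (q + (d + 1)).choose (j + 1) * j.choose q : ℤ) : ℂ) := fun j => by
    rw [contractionCoeff, nsmul_eq_mul, Nat.add_sub_add_right, Nat.add_sub_cancel,
      Nat.add_sub_cancel]
    push_cast
    split_ifs with hj
    · have hs : (-1 : ℂ) ^ (j - q) = (-1) ^ (q + 1) * (-1) ^ (j + 1) := by
        rw [← pow_add, show q + 1 + (j + 1) = (j - q) + 2 * (q + 1) by omega, pow_add, pow_mul]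
        simp
      rw [hs]
      ring
    · rw [Nat.choose_eq_zero_of_lt (by omega : j < q), Nat.cast_zero, mul_zero, mul_zero, mul_zero]
  rw [Finset.sum_congr rfl fun j _ => e j, ← Finset.mul_sum, ← Int.cast_sum, h]
  push_cast
  rw [← pow_add, ← two_mul, pow_mul]
  simp

/-! ### Resolution of the contractions -/

section Resolution

variable {ι W : Type*} [DecidableEq ι] [AddCommGroup W] [Module ℂ W]

/-- Every slot of `E` is resolved once: it is contracted, at the cost of one power of `z - w`, or
replaced by its regular part. -/
theorem resolution_expand {H : ℤ → Finset ι → Finset ι → W} {D : Finset ι} {ε : ι → ℂ}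
    (hrel : ∀ r T S i, i ∈ D → i ∉ T → i ∉ S →
      H r T S = ε i • H (r - 1) (insert i T) S + H r T (insert i S))
    (r : ℤ) (T S E : Finset ι) (hE : E ⊆ D) (hT : Disjoint E T) (hS : Disjoint E S) :
    H r T S = ∑ A ∈ E.powerset, (∏ i ∈ A, ε i) • H (r - A.card) (T ∪ A) (S ∪ E \ A) := by
  induction E using Finset.induction_on with
  | empty => simp
  | insert i E hi ih =>
    rw [Finset.insert_subset_iff] at hE
    rw [Finset.disjoint_insert_left] at hT hS
    rw [ih hE.2 hT.2 hS.2, Finset.sum_powerset_insert hi, ← Finset.sum_add_distrib]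
    refine Finset.sum_congr rfl fun A hA => ?_
    have hA' := Finset.mem_powerset.1 hA
    have hiA : i ∉ A := fun h => hi (hA' h)
    rw [hrel _ (T ∪ A) (S ∪ E \ A) i hE.1 (by simp [hT.1, hiA]) (by simp [hS.1, hi]),
      Finset.prod_insert hiA, Finset.card_insert_of_notMem hiA, Finset.insert_sdiff_insert,
      Finset.sdiff_insert_of_notMem hi, Finset.insert_sdiff_of_notMem _ hiA,
      Finset.union_insert, Finset.union_insert, smul_add, smul_smul, add_comm, mul_comm (ε i)]
    push_cast
    rw [sub_sub]

/-- Both sides are expanded until all slots of `D` are resolved and compared term by term. The point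
is to keep on the right only terms with no regularised slot. -/
theorem resolution_formula {H : ℤ → Finset ι → Finset ι → W} {D : Finset ι} {ε : ι → ℂ}
    (hrel : ∀ r T S i, i ∈ D → i ∉ T → i ∉ S →
      H r T S = ε i • H (r - 1) (insert i T) S + H r T (insert i S))
    (hreg : ∀ (r : ℕ) T S, D ⊆ T ∪ S → H r T S = 0) {p : ℕ} (hp : 1 ≤ p) :
    H (p - 1) ∅ ∅ = ∑ T ∈ D.powerset,
      (contractionCoeff p T.card * ∏ i ∈ T, ε i) • H (p - 1 - T.card) T ∅ := by
  set g : Finset ι → W := fun B => (∏ i ∈ B, ε i) • H (p - 1 - B.card) B (D \ B) with hg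
  have h1 : ∀ T ∈ D.powerset, (contractionCoeff p T.card * ∏ i ∈ T, ε i) •
      H (p - 1 - T.card) T ∅ =
      ∑ B ∈ D.powerset, if T ⊆ B then contractionCoeff p T.card • g B else 0 := fun T hT => by
    have hTD := Finset.mem_powerset.1 hT
    rw [resolution_expand hrel _ T ∅ (D \ T) Finset.sdiff_subset Finset.sdiff_disjoint
      (Finset.disjoint_empty_right _), ← Finset.sum_filter, Finset.smul_sum]
    refine Finset.sum_nbij' (fun A => T ∪ A) (fun B => B \ T) (fun A hA => ?_) (fun B hB => ?_)
      (fun A hA => ?_) (fun B hB => ?_) fun A hA => ?_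
    · exact Finset.mem_filter.2 ⟨Finset.mem_powerset.2 (Finset.union_subset hTD
        ((Finset.mem_powerset.1 hA).trans Finset.sdiff_subset)), Finset.subset_union_left⟩
    · exact Finset.mem_powerset.2 (Finset.sdiff_subset_sdiff
        (Finset.mem_powerset.1 (Finset.mem_filter.1 hB).1) subset_rfl)
    · exact Finset.union_sdiff_cancel_left
        (Finset.disjoint_of_subset_right (Finset.mem_powerset.1 hA) Finset.disjoint_sdiff)
    · exact Finset.union_sdiff_of_subset (Finset.mem_filter.1 hB).2
    · have hd : Disjoint T A :=
        Finset.disjoint_of_subset_right (Finset.mem_powerset.1 hA) Finset.disjoint_sdiff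
      rw [hg]
      dsimp only
      rw [Finset.prod_union hd, Finset.card_union_of_disjoint hd, smul_smul, smul_smul,
        Finset.empty_union, sdiff_sdiff_left, mul_assoc, sub_sub]
      push_cast
      rfl
  rw [Finset.sum_congr rfl h1, Finset.sum_comm,
    resolution_expand hrel _ ∅ ∅ D subset_rfl (Finset.disjoint_empty_right _)
      (Finset.disjoint_empty_right _)]
  refine Finset.sum_congr rfl fun B hB => ?_
  have hBD := Finset.mem_powerset.1 hB
  rw [Finset.empty_union, Finset.empty_union]
  have h2 : ∑ T ∈ D.powerset, (if T ⊆ B then contractionCoeff p T.card • g B else 0) =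
      (∑ T ∈ B.powerset, contractionCoeff p T.card) • g B := by
    rw [← Finset.sum_filter, Finset.sum_smul]
    refine Finset.sum_congr (Finset.ext fun T => ?_) fun _ _ => rfl
    rw [Finset.mem_filter, Finset.mem_powerset, Finset.mem_powerset]
    exact ⟨fun h => h.2, fun h => ⟨h.trans hBD, h⟩⟩
  rw [h2]
  -- If `|B| ≥ p`, the total weight is `1`. Otherwise the remaining exponent `p - 1 - |B|` is
  -- nonnegative and the fully resolved term is zero, so its weight is irrelevant.
  rcases le_or_gt p B.card with h | h
  · rw [Finset.sum_powerset_apply_card, sum_choose_mul_contractionCoeff hp h, one_smul]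
  · have h0 : g B = 0 := by
      have := hreg (p - 1 - B.card) B (D \ B) (by
        rw [Finset.union_sdiff_of_subset hBD])
      rw [hg]
      dsimp only
      rw [show (p : ℤ) - 1 - B.card = ((p - 1 - B.card : ℕ) : ℤ) by omega, this, smul_zero]
    rw [h0, smul_zero]
    exact h0

end Resolution

/-! ### Contracting the factors of a product of two families -/

section Slots

/-- The family with `x` on `T`, `R` on `S \ T` and `q` elsewhere. -/
def mixed {ι X : Type*} [DecidableEq ι] (q x R : ι → X) (T S : Finset ι) (i : ι) : X :=
  if i ∈ T then x i else if i ∈ S then R i else q i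

/-- Exchange of the two variables in an exponent. -/
def swapLex : ℤ ×ₗ ℤ ≃ ℤ ×ₗ ℤ := ofLex.trans ((Equiv.prodComm ℤ ℤ).trans toLex)

/-- A pair of two-variable operators that agree as formal distributions. -/
def IsRegular (U W : HVertexOperator (ℤ ×ₗ ℤ) ℂ V V) : Prop :=
  ∀ a, U.coeff a = W.coeff (swapLex a)

theorem isRegular_iff {U W : HVertexOperator (ℤ ×ₗ ℤ) ℂ V V} :
    IsRegular U W ↔ ∀ m k v, mode2 U k m v = mode2 W m k v := by
  refine ⟨fun h m k v => by rw [mode2, h]; rfl, fun h a => LinearMap.ext fun v => ?_⟩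
  have := h (-(ofLex a).2 - 1) (-(ofLex a).1 - 1) v
  simp only [mode2, neg_sub, sub_neg_eq_add, add_sub_cancel_left] at this
  exact this

theorem IsRegular.modeDiff {U W : HVertexOperator (ℤ ×ₗ ℤ) ℂ V V} (h : IsRegular U W) (v : V) :
    modeDiff U W v = 0 := by
  funext m k
  exact sub_eq_zero.2 (isRegular_iff.1 h m k v)

theorem IsRegular.mul {U W U' W' : HVertexOperator (ℤ ×ₗ ℤ) ℂ V V} (h : IsRegular U W)
    (h' : IsRegular U' W') (hc : Comm U U') (hc' : Comm W W') :
    IsRegular (mul U U') (ChiralField.mul W W') := fun a => LinearMap.ext fun v => by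
  rw [coeff_mul hc, coeff_mul hc', ← finsum_comp_equiv swapLex]
  exact finsum_congr fun b => by rw [h, h']; rfl

theorem IsRegular.listMul {ι : Type*} {b b' : HVertexOperator (ℤ ×ₗ ℤ) ℂ V V}
    {f f' : ι → HVertexOperator (ℤ ×ₗ ℤ) ℂ V V} (hb : IsRegular b b')
    (hf : ∀ i, IsRegular (f i) (f' i)) (hc : CommFamily b f) (hc' : CommFamily b' f') {l : List ι}
    (hl : l.Nodup) : IsRegular (listMul b f l) (ChiralField.listMul b' f' l) := by
  induction l with
  | nil => exact hb
  | cons i l ih =>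
    exact (hf i).mul (ih (List.nodup_cons.1 hl).2) (hc.comm_tail hl) (hc'.comm_tail hl)

variable {ι : Type*} [DecidableEq ι] {b : HVertexOperator (ℤ ×ₗ ℤ) ℂ V V}
  {q x R q' x' R' : ι → HVertexOperator (ℤ ×ₗ ℤ) ℂ V V}
  {D : Finset ι} {ε : ι → ℂ} {l : List ι}

theorem mulDiff_listMul_mixed (hc : ∀ T S, CommFamily b (mixed q x R T S))
    (hrel : ∀ i ∈ D, mulDiff (q i) = ε i • x i + mulDiff (R i)) (hl : l.Nodup)
    (hDl : ∀ i ∈ D, i ∈ l) {i : ι} (hi : i ∈ D) {T S : Finset ι} (hT : i ∉ T) (hS : i ∉ S) :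
    mulDiff (listMul b (mixed q x R T S) l) = ε i • listMul b (mixed q x R (insert i T) S) l +
      mulDiff (listMul b (mixed q x R T (insert i S)) l) := by
  refine mulDiff_listMul (hc _ _) (hc _ _) (hc _ _) (i := i) ?_ (fun j hj => ?_) (fun j hj => ?_)
    hl (hDl i hi)
  · simpa [mixed, hT, hS] using hrel i hi
  · simp [mixed, hj]
  · simp [mixed, hj]

/-- The recursion assumed in `resolution_formula`: a residue with exponent `r` is one with exponent
`r - 1` after multiplication by `z - w`. The sign `-ε` in the reversed ordering compensates for `w -
z`. -/
theorem res_listMul_mixed (hc : ∀ T S, CommFamily b (mixed q x R T S))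
    (hc' : ∀ T S, CommFamily b (mixed q' x' R' T S))
    (hrel : ∀ i ∈ D, mulDiff (q i) = ε i • x i + mulDiff (R i))
    (hrel' : ∀ i ∈ D, mulDiff (q' i) = -ε i • x' i + mulDiff (R' i)) (hl : l.Nodup)
    (hDl : ∀ i ∈ D, i ∈ l) (k : ℤ) (v : V) (r : ℤ) (T S : Finset ι) (i : ι) (hi : i ∈ D)
    (hT : i ∉ T) (hS : i ∉ S) :
    resOut r (listMul b (mixed q x R T S) l) k v - resIn r (listMul b (mixed q' x' R' T S) l) k v =
      ε i • (resOut (r - 1) (listMul b (mixed q x R (insert i T) S) l) k v -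
        resIn (r - 1) (listMul b (mixed q' x' R' (insert i T) S) l) k v) +
      (resOut r (listMul b (mixed q x R T (insert i S)) l) k v -
        resIn r (listMul b (mixed q' x' R' T (insert i S)) l) k v) := by
  have h1 := congrArg (fun U => resOut (r - 1) U k v)
    (mulDiff_listMul_mixed hc hrel hl hDl hi hT hS)
  have h2 := congrArg (fun U => resIn (r - 1) U k v)
    (mulDiff_listMul_mixed hc' hrel' hl hDl hi hT hS)
  simp only [resOut_add, resOut_smul, resOut_mulDiff, resIn_add, resIn_smul, resIn_mulDiff,
    sub_add_cancel] at h1 h2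
  rw [h1, ← neg_neg (resIn r (listMul b (mixed q' x' R' T S) l) k v), h2, smul_sub]
  module

theorem isRegular_listMul_mixed (hb : IsRegular b b) (hc : ∀ T S, CommFamily b (mixed q x R T S))
    (hc' : ∀ T S, CommFamily b (mixed q' x' R' T S)) (hq : ∀ i ∉ D, IsRegular (q i) (q' i))
    (hx : ∀ i, IsRegular (x i) (x' i)) (hR : ∀ i, IsRegular (R i) (R' i)) (hl : l.Nodup)
    {T S : Finset ι} (hTS : D ⊆ T ∪ S) :
    IsRegular (listMul b (mixed q x R T S) l) (listMul b (mixed q' x' R' T S) l) := by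
  refine hb.listMul (fun i => ?_) (hc T S) (hc' T S) hl
  rw [mixed, mixed]
  split_ifs with h1 h2
  · exact hx i
  · exact hR i
  · exact hq i fun hi => by
      have := hTS hi
      rw [Finset.mem_union] at this
      tauto

/-- Induction on the number of unresolved slots in `D`: one factor `z - w` contracts a slot, and
with no slot left both orderings agree. -/
theorem local_listMul_mixed (hb : IsRegular b b) (hc : ∀ T S, CommFamily b (mixed q x R T S))
    (hc' : ∀ T S, CommFamily b (mixed q' x' R' T S)) (hq : ∀ i ∉ D, IsRegular (q i) (q' i))
    (hx : ∀ i, IsRegular (x i) (x' i)) (hR : ∀ i, IsRegular (R i) (R' i))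
    (hrel : ∀ i ∈ D, mulDiff (q i) = ε i • x i + mulDiff (R i))
    (hrel' : ∀ i ∈ D, mulDiff (q' i) = -ε i • x' i + mulDiff (R' i)) (hl : l.Nodup)
    (hDl : ∀ i ∈ D, i ∈ l) (v : V) (N : ℕ) (T S : Finset ι) (hN : (D \ (T ∪ S)).card = N) :
    diffOp^[N] (modeDiff (listMul b (mixed q x R T S) l)
      (listMul b (mixed q' x' R' T S) l) v) = 0 := by
  induction N generalizing T S with
  | zero =>
    rw [Finset.card_eq_zero, Finset.sdiff_eq_empty_iff_subset] at hN
    exact (isRegular_listMul_mixed hb hc hc' hq hx hR hl hN).modeDiff v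
  | succ N ih =>
    obtain ⟨i, hi⟩ : (D \ (T ∪ S)).Nonempty := Finset.card_pos.1 (by omega)
    rw [Finset.mem_sdiff, Finset.mem_union, not_or] at hi
    have hcard : ((D \ (T ∪ S)).erase i).card = N := by
      rw [Finset.card_erase_of_mem (by simpa using hi), hN, Nat.add_sub_cancel]
    have e1 : D \ (insert i T ∪ S) = (D \ (T ∪ S)).erase i := by
      rw [Finset.insert_union, Finset.sdiff_insert]
    have e2 : D \ (T ∪ insert i S) = (D \ (T ∪ S)).erase i := by
      rw [Finset.union_insert, Finset.sdiff_insert]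
    have i1 := ih (insert i T) S (by rw [e1, hcard])
    have i2 := ih T (insert i S) (by rw [e2, hcard])
    have hadd : ∀ c d : ℤ → ℤ → V, diffOp (c + d) = diffOp c + diffOp d := fun c d => by
      funext m k
      simp only [diffOp, Pi.add_apply]
      abel
    have hsmul : ∀ (a : ℂ) (c : ℤ → ℤ → V), diffOp (a • c) = a • diffOp c := fun a c => by
      funext m k
      simp only [diffOp, Pi.smul_apply, smul_sub]
    have hadd' : ∀ (N : ℕ) (c d : ℤ → ℤ → V),
        diffOp^[N] (c + d) = diffOp^[N] c + diffOp^[N] d := fun N => by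
      induction N with
      | zero => exact fun _ _ => rfl
      | succ N ih => intro c d; simp only [Function.iterate_succ_apply, hadd, ih]
    have hsmul' : ∀ (N : ℕ) (a : ℂ) (c : ℤ → ℤ → V),
        diffOp^[N] (a • c) = a • diffOp^[N] c := fun N => by
      induction N with
      | zero => exact fun _ _ => rfl
      | succ N ih => intro a c; simp only [Function.iterate_succ_apply, hsmul, ih]
    have hstep : diffOp (modeDiff (listMul b (mixed q x R T S) l)
        (listMul b (mixed q' x' R' T S) l) v) =
        ε i • modeDiff (listMul b (mixed q x R (insert i T) S) l)
          (listMul b (mixed q' x' R' (insert i T) S) l) v +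
        diffOp (modeDiff (listMul b (mixed q x R T (insert i S)) l)
          (listMul b (mixed q' x' R' T (insert i S)) l) v) := by
      rw [← modeDiff_mulDiff, ← modeDiff_mulDiff,
        mulDiff_listMul_mixed hc hrel hl hDl hi.1 hi.2.1 hi.2.2,
        mulDiff_listMul_mixed hc' hrel' hl hDl hi.1 hi.2.1 hi.2.2]
      have hn : ∀ (A : HVertexOperator (ℤ ×ₗ ℤ) ℂ V V) p q, mode2 (-A) p q = -mode2 A p q :=
        fun A p q => by rw [mode2, map_neg]; rfl
      funext m k
      simp only [modeDiff, hn, mode2_add, mode2_smul, Pi.add_apply, Pi.smul_apply,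
        LinearMap.add_apply, LinearMap.smul_apply, LinearMap.neg_apply]
      module
    -- The contracted term is killed by the remaining `N` powers; the regularised one still carries
    -- `N + 1` powers, one more than it needs.
    rw [Function.iterate_succ_apply, hstep, hadd', hsmul', i1, smul_zero, zero_add,
      ← Function.iterate_succ_apply, Function.iterate_succ_apply', i2]
    exact diffOp_iterate_zero 1

end Slots

/-! ### Derivatives and covariant derivatives of products -/

/-- Negative products in terms of the normally ordered product with derivatives. -/
theorem prod_zero_der_iterate (A B : VertexOperator ℂ V) (k : ℕ) :
    prod 0 (der^[k] A) B = (k.factorial : ℂ) • prod (-k) A B := by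
  induction k generalizing A with
  | zero => simp
  | succ k ih =>
    rw [Function.iterate_succ_apply, ih, prod, resProd_der, smul_smul, Nat.factorial_succ, prod]
    congr 1
    · push_cast; ring
    · congr 1; push_cast; ring

/-- The covariant derivative attached to a pair `X, Y`. -/
def covOp (X Y O : VertexOperator ℂ V) : VertexOperator ℂ V :=
  prod 0 (-prod 0 X Y) O + prod 0 X (prod 0 Y O) + prod 0 (-prod 0 X Y) O

theorem Comm.neg_prod_right {A X Y : VertexOperator ℂ V} (hX : Comm A X) (hY : Comm A Y) :
    Comm A (-prod 0 X Y) := (hX.resProd_right hY _).neg_right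

theorem Comm.covOp_right {A X Y O : VertexOperator ℂ V} (hX : Comm A X) (hY : Comm A Y)
    (hO : Comm A O) : Comm A (covOp X Y O) :=
  (((hX.neg_prod_right hY).resProd_right hO _).add_right
    (hX.resProd_right (hY.resProd_right hO _) _)).add_right
    ((hX.neg_prod_right hY).resProd_right hO _)

/-- A field commuting with `X`, `Y` and `E` behaves as a constant for each of the residue products
that make up the covariant derivative. -/
theorem covOp_mul {X Y E B : VertexOperator ℂ V} (hX : Comm B X) (hY : Comm B Y)
    (hE : Comm B E) : covOp X Y (mul E B) = mul (covOp X Y E) B := by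
  have hA := hX.neg_prod_right hY
  have e1 : prod 0 (-prod 0 X Y) (mul E B) = mul (prod 0 (-prod 0 X Y) E) B :=
    resProd_mul hA.symm hE.symm _
  have e2 : prod 0 Y (mul E B) = mul (prod 0 Y E) B := resProd_mul hY.symm hE.symm _
  have e3 : prod 0 X (mul (prod 0 Y E) B) = mul (prod 0 X (prod 0 Y E)) B :=
    resProd_mul hX.symm (hY.resProd_right hE _).symm _
  have c1 : Comm (prod 0 (-prod 0 X Y) E) B := (hA.resProd_right hE _).symm
  have c2 : Comm (prod 0 X (prod 0 Y E)) B :=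
    (hX.resProd_right (hY.resProd_right hE _) _).symm
  rw [covOp, covOp, e1, e2, e3, mul_add_left (c1.symm.add_right c2.symm).symm c1,
    mul_add_left c1 c2]

theorem covOp_mul' {X Y E B : VertexOperator ℂ V} (hX : Comm E X) (hY : Comm E Y)
    (hB : Comm E B) : covOp X Y (mul E B) = mul E (covOp X Y B) := by
  rw [mul_comm_of_comm hB, covOp_mul hX hY hB, mul_comm_of_comm (hX.covOp_right hY hB)]

theorem covOp_listMul {ι : Type*} {X Y : VertexOperator ℂ V} {f g : ι → VertexOperator ℂ V}
    (hf : CommFamily (one V) f) {i : ι} (hi : g i = covOp X Y (f i))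
    (hfg : ∀ j, j ≠ i → f j = g j) (hX : ∀ j, j ≠ i → Comm (f j) X)
    (hY : ∀ j, j ≠ i → Comm (f j) Y) {l : List ι} (hl : l.Nodup) (hil : i ∈ l) :
    covOp X Y (listMul (one V) f l) = listMul (one V) g l := by
  induction l with
  | nil => exact absurd hil List.not_mem_nil
  | cons j l ih =>
    have hl' := List.nodup_cons.1 hl
    have hc := hf.comm_tail hl
    rw [listMul_cons, listMul_cons]
    rcases List.mem_cons.1 hil with rfl | hil
    · have hne : ∀ k ∈ l, k ≠ i := fun k hk h => hl'.1 (h ▸ hk)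
      rw [covOp_mul (hf.comm_listMul hl'.2 (fun k hk => (hX k (hne k hk)).symm)
        (comm_one X)).symm (hf.comm_listMul hl'.2 (fun k hk => (hY k (hne k hk)).symm)
        (comm_one Y)).symm hc.symm, hi, listMul_congr fun k hk => hfg k (hne k hk)]
    · have hne : j ≠ i := fun h => hl'.1 (h ▸ hil)
      rw [covOp_mul' (hX j hne) (hY j hne) hc, ih hl'.2 hil, hfg j hne]

/-! ### Contraction of a single boson -/

namespace BosonPair

variable {X Y : VertexOperator ℂ V} (h : BosonPair X Y)

include h

theorem isRegular_sq : IsRegular (comp X X) (comp X X) :=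
  isRegular_iff.2 fun m k v => h.comm_left.ncoeff m k v

theorem isRegular_bosonD : IsRegular (comp (bosonD X Y) (bosonD X Y))
    (comp (bosonD X Y) (bosonD X Y)) :=
  isRegular_iff.2 fun m k v => h.comm_bosonD.ncoeff m k v

/-- On the support of `δ(z-w)` the numerator `X(w)²` may be replaced by `X(z) X(w)`, and `δ(z-w)` is
the sum of the expansions of `1/(z-w)` for `|z| > |w|` and of `1/(w-z)` for `|w| > |z|`. The sum
over modes of `X²` is cut at `m` accordingly. -/
theorem ncoeff_bosonD_sub (m k : ℤ) (v : V) :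
    ((bosonD X Y)[[m]]) ((X[[k]]) v) =
      (X[[k]]) (((bosonD X Y)[[m]]) v) + mode2 (mul (invDiff V) (comp X X)) k m v +
        mode2 (mul (invDiff V) (comp X X)) m k v := by
  rw [h.bracket_bosonD_left m k v, ncoeff_shift, add_assoc]
  congr 1
  rw [mode2_invDiff_mul, mode2_invDiff_mul, ncoeff_mul_left h.comm_left,
    finsum_int_split (mul_support_finite_left h.comm_left (k + m - 1) v) m, add_comm]
  congr 1 <;> refine finsum_congr fun j => ?_
  · rw [mode2_comp, show k + m - 1 - (m - 1 - (j : ℤ)) = k + j by ring]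
  · rw [mode2_comp, h.comm_left.ncoeff, show k + m - 1 - (m + (j : ℤ)) = k - 1 - j by ring]

theorem isRegular_bosonD_left :
    IsRegular (comp (bosonD X Y) X - (1 : ℂ) • mul (invDiff V) (comp X X))
      (comp X (bosonD X Y) - (-1 : ℂ) • mul (invDiff V) (comp X X)) := by
  refine isRegular_iff.2 fun m k v => ?_
  rw [mode2_sub, mode2_sub, LinearMap.sub_apply, LinearMap.sub_apply, mode2_comp, mode2_comp,
    h.ncoeff_bosonD_sub, mode2_smul, mode2_smul, LinearMap.smul_apply, LinearMap.smul_apply]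
  module

theorem isRegular_left_bosonD :
    IsRegular (comp X (bosonD X Y) - (-1 : ℂ) • mul (invDiff V) (comp X X))
      (comp (bosonD X Y) X - (1 : ℂ) • mul (invDiff V) (comp X X)) := by
  refine isRegular_iff.2 fun m k v => ?_
  rw [mode2_sub, mode2_sub, LinearMap.sub_apply, LinearMap.sub_apply, mode2_comp, mode2_comp,
    h.ncoeff_bosonD_sub, mode2_smul, mode2_smul, LinearMap.smul_apply, LinearMap.smul_apply]
  module

end BosonPair

/-! ### The fields `𝒳_I` as products of commuting fields -/

namespace SymplecticBosons

variable {n : ℕ} (S : SymplecticBosons n V)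

theorem comm_of_OPE_zero {A B : VertexOperator ℂ V} (h : OPE A B 0 fun _ => 0) : Comm A B :=
  comm_iff.2 fun m k v => by
    have := LinearMap.congr_fun (h m k) v
    rw [Finset.Icc_eq_empty (by omega), Finset.sum_empty, LinearMap.zero_apply,
      LinearMap.sub_apply] at this
    exact sub_eq_zero.1 this

theorem bracket_XY (i j : Fin n) (m : ℤ) :
    Bracket ((S.X i)[[m]]) (S.Y j) (if i = j then shift m (one V) else 0) := fun k v => by
  have := LinearMap.congr_fun (S.ope_XY i j m k) v
  rw [Finset.Icc_self, Finset.sum_singleton, Nat.sub_self, Ring.choose_zero_right, Int.cast_one,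
    one_smul, Nat.cast_one, sub_self, sub_zero, LinearMap.sub_apply] at this
  rw [← sub_eq_iff_eq_add']
  refine Eq.trans this ?_
  split_ifs
  · rw [ncoeff_shift, add_comm]
  · simp

theorem comm_XX (i j : Fin n) : Comm (S.X i) (S.X j) := comm_of_OPE_zero (S.ope_XX i j)

theorem comm_YY (i j : Fin n) : Comm (S.Y i) (S.Y j) := comm_of_OPE_zero (S.ope_YY i j)

theorem comm_XY {i j : Fin n} (hij : i ≠ j) : Comm (S.X i) (S.Y j) :=
  comm_iff.2 fun m k v => by
    have := S.bracket_XY i j m k v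
    rw [if_neg hij] at this
    simpa using this

theorem bosonPair (i : Fin n) : BosonPair (S.X i) (S.Y i) where
  comm_left := S.comm_XX i i
  comm_right := S.comm_YY i i
  bracket m := by
    have := S.bracket_XY i i m
    rwa [if_pos rfl] at this

/-- The factor of `𝒳_I` built from the `i`-th bosons. -/
def factor (I : Finset (Fin n)) (i : Fin n) : VertexOperator ℂ V :=
  if i ∈ I then bosonD (S.X i) (S.Y i) else S.X i

theorem comm_factor_X (I : Finset (Fin n)) {i j : Fin n} (hij : i ≠ j) :
    Comm (S.factor I i) (S.X j) := by
  rw [factor]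
  split_ifs
  · exact ((S.comm_XX j i).covOp_right (S.comm_XY hij.symm) (S.comm_XX j i)).symm
  · exact S.comm_XX i j

theorem comm_factor_Y (I : Finset (Fin n)) {i j : Fin n} (hij : i ≠ j) :
    Comm (S.factor I i) (S.Y j) := by
  rw [factor]
  split_ifs
  · exact ((S.comm_XY hij).symm.covOp_right (S.comm_YY j i) (S.comm_XY hij).symm).symm
  · exact S.comm_XY hij

theorem comm_factor (I J : Finset (Fin n)) {i j : Fin n} (hij : i ≠ j) :
    Comm (S.factor I i) (S.factor J j) := by
  rw [factor.eq_1 S J]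
  split_ifs
  · exact (S.comm_factor_X I hij).covOp_right (S.comm_factor_Y I hij) (S.comm_factor_X I hij)
  · exact S.comm_factor_X I hij

theorem commFamily_factor (I : Finset (Fin n)) : CommFamily (one V) (S.factor I) where
  comm _ _ hij := S.comm_factor I I hij
  base _ := comm_one _

theorem calX_eq : S.calX = listMul (one V) (S.factor ∅) (List.finRange n) := by
  have key : ∀ l : List (Fin n), l.Nodup →
      (l.map S.X).foldr (prod 0) (one V) = listMul (one V) (S.factor ∅) l := fun l hl => by
    induction l with
    | nil => rfl
    | cons i l ih =>
      have hc := (S.commFamily_factor ∅).comm_tail hl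
      rw [List.map_cons, List.foldr_cons, ih (List.nodup_cons.1 hl).2, listMul_cons]
      rw [show S.X i = S.factor ∅ i by rw [factor, if_neg (Finset.notMem_empty i)],
        prod_zero_eq_mul hc]
  rw [calX, List.ofFn_eq_map]
  exact key _ (List.nodup_finRange n)

theorem covD_listMul (I : Finset (Fin n)) {i : Fin n} (hi : i ∉ I) :
    S.covD i (listMul (one V) (S.factor I) (List.finRange n)) =
      listMul (one V) (S.factor (insert i I)) (List.finRange n) := by
  refine covOp_listMul (X := S.X i) (Y := S.Y i) (i := i) (S.commFamily_factor I) ?_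
    (fun j hj => ?_) (fun j hj => S.comm_factor_X I hj) (fun j hj => S.comm_factor_Y I hj)
    (List.nodup_finRange n) (List.mem_finRange i)
  · rw [factor, factor, if_pos (Finset.mem_insert_self i I), if_neg hi]
    rfl
  · rw [factor, factor]
    simp [hj]

theorem calXI_eq (I : Finset (Fin n)) :
    S.calXI I = listMul (one V) (S.factor I) (List.finRange n) := by
  have key : ∀ l : List (Fin n), l.Nodup → l.foldr S.covD S.calX =
      listMul (one V) (S.factor l.toFinset) (List.finRange n) := fun l hl => by
    induction l with
    | nil => exact S.calX_eq
    | cons i l ih =>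
      have hl' := List.nodup_cons.1 hl
      rw [List.foldr_cons, ih hl'.2, S.covD_listMul _ (by simpa using hl'.1), List.toFinset_cons]
  rw [calXI, key _ (Finset.sort_nodup I _), Finset.sort_toFinset]

theorem comp_calXI (I J : Finset (Fin n)) : comp (S.calXI I) (S.calXI J) =
    listMul (comp (one V) (one V)) (fun i => comp (S.factor I i) (S.factor J i))
      (List.finRange n) := by
  rw [calXI_eq, calXI_eq]
  exact comp_listMul (S.commFamily_factor I) (S.commFamily_factor J)
    (fun i j hij => S.comm_factor I J hij) (List.nodup_finRange n)

/-! ### The contractions between `𝒳_I` and `𝒳_J` -/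

/-- The product `X_i(z) X_i(w)`. -/
def sq (i : Fin n) : HVertexOperator (ℤ ×ₗ ℤ) ℂ V V := comp (S.X i) (S.X i)

/-- The coefficient of the contraction of the `i`-th factors of `𝒳_I` and `𝒳_J`. -/
def contr (I J : Finset (Fin n)) (i : Fin n) : ℂ :=
  (if i ∈ I then 1 else 0) - if i ∈ J then 1 else 0

theorem contr_swap (I J : Finset (Fin n)) (i : Fin n) : contr J I i = -contr I J i :=
  (neg_sub _ _).symm

/-- The product of the `i`-th factors. -/
def pair (I J : Finset (Fin n)) (i : Fin n) : HVertexOperator (ℤ ×ₗ ℤ) ℂ V V :=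
  comp (S.factor I i) (S.factor J i)

/-- The product of the `i`-th factors without their contraction. -/
def reg (I J : Finset (Fin n)) (i : Fin n) : HVertexOperator (ℤ ×ₗ ℤ) ℂ V V :=
  S.pair I J i - contr I J i • mul (invDiff V) (S.sq i)

/-- Different slots are built from different bosons whatever their state, since `invDiff` is scalar;
no commutation inside one slot is claimed. -/
theorem commFamily_mixed (I J T T' : Finset (Fin n)) :
    CommFamily (comp (one V) (one V)) (mixed (S.pair I J) S.sq (S.reg I J) T T') := by
  have hX : ∀ i j, i ≠ j → ∀ {A : VertexOperator ℂ V}, Comm A (S.X j) → Comm A (S.factor I j) →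
      Comm A (S.factor J j) → Comm A (mixed (S.pair I J) S.sq (S.reg I J) T T' j) := by
    intro i j hij A h1 h2 h3
    rw [mixed]
    split_ifs
    · exact h1.comp_right h1
    · exact (h2.comp_right h3).sub_right (((comm_invDiff _).symm.mul_right (comm_invDiff A)
        (h1.comp_right h1)).smul_right _)
    · exact h2.comp_right h3
  refine ⟨fun i j hij => ?_, fun i => ?_⟩
  · have h1 : Comm (mixed (S.pair I J) S.sq (S.reg I J) T T' j) (S.X i) :=
      (hX i j hij (S.comm_XX i j) (S.comm_factor_X I hij.symm).symm
        (S.comm_factor_X J hij.symm).symm).symm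
    have h2 : ∀ K, Comm (mixed (S.pair I J) S.sq (S.reg I J) T T' j) (S.factor K i) := fun K =>
      (hX i j hij (S.comm_factor_X K hij) (S.comm_factor K I hij) (S.comm_factor K J hij)).symm
    refine Comm.symm ?_
    rw [mixed.eq_1 _ _ _ _ _ i]
    split_ifs
    · exact h1.comp_right h1
    · exact ((h2 I).comp_right (h2 J)).sub_right (((comm_invDiff _).symm.mul_right
        (comm_invDiff _) (h1.comp_right h1)).smul_right _)
    · exact (h2 I).comp_right (h2 J)
  · have h1 : ∀ A : HVertexOperator (ℤ ×ₗ ℤ) ℂ V V, Comm A (one V) := fun A a b v => by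
      rw [VertexOperator.coeff_eq_ncoeff, ncoeff_one]
      split_ifs <;> simp
    exact (h1 _).comp_right (h1 _)

theorem isRegular_one : IsRegular (comp (one V) (one V)) (comp (one V) (one V)) :=
  isRegular_iff.2 fun m k v => (comm_one (one V)).ncoeff m k v

theorem isRegular_pair {I J : Finset (Fin n)} {i : Fin n} (hi : i ∈ I ↔ i ∈ J) :
    IsRegular (S.pair I J i) (S.pair J I i) := by
  rw [pair, pair, factor, factor]
  by_cases h : i ∈ I
  · rw [if_pos h, if_pos (hi.1 h)]
    exact (S.bosonPair i).isRegular_bosonD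
  · rw [if_neg h, if_neg fun h' => h (hi.2 h')]
    exact (S.bosonPair i).isRegular_sq

/-- If `i` lies in both sets or in neither, there is no contraction and the factors commute.
Otherwise the subtracted series accounts for the whole commutator. -/
theorem isRegular_reg (I J : Finset (Fin n)) (i : Fin n) :
    IsRegular (S.reg I J i) (S.reg J I i) := by
  by_cases h : i ∈ I ↔ i ∈ J
  · have h0 : ∀ {I J : Finset (Fin n)}, (i ∈ I ↔ i ∈ J) → S.reg I J i = S.pair I J i :=
      fun h => by rw [reg, contr, if_congr h rfl rfl, sub_self, zero_smul, sub_zero]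
    rw [h0 h, h0 h.symm]
    exact S.isRegular_pair h
  · by_cases hI : i ∈ I
    · have hJ : i ∉ J := fun hJ => h ⟨fun _ => hJ, fun _ => hI⟩
      simp only [reg, pair, factor, contr, hI, hJ, if_true, if_false, sub_zero, zero_sub]
      exact (S.bosonPair i).isRegular_bosonD_left
    · have hJ : i ∈ J := by tauto
      simp only [reg, pair, factor, contr, hI, hJ, if_true, if_false, sub_zero, zero_sub]
      exact (S.bosonPair i).isRegular_left_bosonD

theorem mulDiff_pair (I J : Finset (Fin n)) (i : Fin n) :
    mulDiff (S.pair I J i) = contr I J i • S.sq i + mulDiff (S.reg I J i) := by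
  have h : mulDiff (S.reg I J i) = mulDiff (S.pair I J i) -
      contr I J i • mulDiff (mul (invDiff V) (S.sq i)) := mode2_ext fun p q v => by
    simp only [reg, mode2_mulDiff, mode2_sub, mode2_smul, LinearMap.sub_apply,
      LinearMap.smul_apply]
    module
  rw [h, mulDiff_invDiff_mul, add_sub_cancel]

/-- A contracted slot holds `X_i(z) X_i(w)`, which is the slot of an index belonging to neither set.
So contraction removes `T` from both index sets and yields a product of two fields again. -/
theorem comp_calXI_sdiff (I J T : Finset (Fin n)) : comp (S.calXI (I \ T)) (S.calXI (J \ T)) =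
    listMul (comp (one V) (one V)) (mixed (S.pair I J) S.sq (S.reg I J) T ∅) (List.finRange n) := by
  rw [comp_calXI]
  refine listMul_congr fun i _ => ?_
  by_cases hT : i ∈ T <;> simp [mixed, pair, factor, sq, hT]

theorem mulDiff_pair_swap (I J : Finset (Fin n)) (i : Fin n) :
    mulDiff (S.pair J I i) = -contr I J i • S.sq i + mulDiff (S.reg J I i) := by
  rw [mulDiff_pair, contr_swap]

theorem isRegular_pair_of_notMem {I J : Finset (Fin n)} (i : Fin n) (hi : i ∉ I \ J ∪ J \ I) :
    IsRegular (S.pair I J i) (S.pair J I i) :=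
  S.isRegular_pair (by
    simp only [Finset.mem_union, Finset.mem_sdiff] at hi
    tauto)

theorem isRegular_sq (i : Fin n) : IsRegular (S.sq i) (S.sq i) := (S.bosonPair i).isRegular_sq

/-- The products of `𝒳_I` and `𝒳_J` in terms of the sets `T` of contracted factors. -/
theorem prod_calXI (I J : Finset (Fin n)) {p : ℕ} (hp : 1 ≤ p) :
    prod p (S.calXI I) (S.calXI J) = ∑ T ∈ (I \ J ∪ J \ I).powerset,
      (contractionCoeff p T.card * ∏ i ∈ T, contr I J i) •
        prod (p - T.card) (S.calXI (I \ T)) (S.calXI (J \ T)) := by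
  refine vo_ext fun k v => ?_
  have key := resolution_formula (D := I \ J ∪ J \ I) (ε := contr I J)
    (H := fun r T T' =>
      resOut r (listMul (comp (one V) (one V)) (mixed (S.pair I J) S.sq (S.reg I J) T T')
        (List.finRange n)) k v -
      resIn r (listMul (comp (one V) (one V)) (mixed (S.pair J I) S.sq (S.reg J I) T T')
        (List.finRange n)) k v)
    (res_listMul_mixed (S.commFamily_mixed I J) (S.commFamily_mixed J I)
      (fun i _ => S.mulDiff_pair I J i) (fun i _ => S.mulDiff_pair_swap I J i)
      (List.nodup_finRange n) (fun i _ => List.mem_finRange i) k v)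
    (fun r T T' hT => by
      rw [resOut_sub_resIn, (isRegular_listMul_mixed isRegular_one (S.commFamily_mixed I J)
        (S.commFamily_mixed J I) S.isRegular_pair_of_notMem S.isRegular_sq (S.isRegular_reg I J)
        (List.nodup_finRange n) hT).modeDiff v, diffOp_iterate_zero]
      rfl) hp
  have e : ∀ (r : ℤ) (T : Finset (Fin n)),
      resOut r (listMul (comp (one V) (one V)) (mixed (S.pair I J) S.sq (S.reg I J) T ∅)
        (List.finRange n)) k v -
      resIn r (listMul (comp (one V) (one V)) (mixed (S.pair J I) S.sq (S.reg J I) T ∅)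
        (List.finRange n)) k v =
      ((prod (r + 1) (S.calXI (I \ T)) (S.calXI (J \ T)))[[k]]) v := fun r T => by
    rw [← comp_calXI_sdiff, ← comp_calXI_sdiff, prod, ncoeff_resProd_eq_sub, add_sub_cancel_right]
  simp only [e, Finset.sdiff_empty, sub_add_cancel] at key
  rw [key, map_sum, Finset.sum_apply, LinearMap.sum_apply]
  refine Finset.sum_congr rfl fun T _ => ?_
  rw [ncoeff_smul, LinearMap.smul_apply, show (p : ℤ) - 1 - T.card + 1 = p - T.card by ring]

theorem OPE_calXI (I J : Finset (Fin n)) :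
    OPE (S.calXI I) (S.calXI J) (I \ J ∪ J \ I).card fun p => prod p (S.calXI I) (S.calXI J) := by
  refine OPE_of_local fun v => ?_
  have h := local_listMul_mixed (D := I \ J ∪ J \ I) (ε := contr I J) isRegular_one
    (S.commFamily_mixed I J) (S.commFamily_mixed J I) S.isRegular_pair_of_notMem S.isRegular_sq
    (S.isRegular_reg I J) (fun i _ => S.mulDiff_pair I J i)
    (fun i _ => S.mulDiff_pair_swap I J i) (List.nodup_finRange n)
    (fun i _ => List.mem_finRange i) v _ ∅ ∅ rfl
  rw [← comp_calXI_sdiff, ← comp_calXI_sdiff] at h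
  simpa only [Finset.sdiff_empty, Finset.empty_union] using h

theorem prod_calXI_eq_zero (I J : Finset (Fin n)) {p : ℕ} (hp : (I \ J ∪ J \ I).card + 1 ≤ p) :
    prod p (S.calXI I) (S.calXI J) = 0 := by
  rw [S.prod_calXI I J (by omega)]
  refine Finset.sum_eq_zero fun T hT => ?_
  have := Finset.card_le_card (Finset.mem_powerset.1 hT)
  rw [contractionCoeff, if_neg (by omega), zero_mul, zero_smul]

end SymplecticBosons

/-! ### Reindexing -/

section Reindex

variable {n : ℕ} {W : Type*} [AddCommMonoid W]

theorem mem_removing {L A : Finset (Fin n)} {a : ℕ} :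
    A ∈ removing L a ↔ A ⊆ L ∧ (L \ A).card = a := by
  rw [removing, Finset.mem_filter, Finset.mem_powerset]

theorem mem_indexPairs {L M : Finset (Fin n)} {p : ℕ} {ab : ℕ × ℕ} :
    ab ∈ indexPairs L M p ↔ ab.1 ≤ L.card ∧ ab.2 ≤ M.card ∧ p ≤ ab.1 + ab.2 := by
  rw [indexPairs, Finset.mem_filter, Finset.mem_product, Finset.mem_range, Finset.mem_range,
    Nat.lt_succ_iff, Nat.lt_succ_iff, and_assoc]

/-- A set `T` of contracted factors corresponds to the pair of survivors `(L \ T, M \ T)`, graded by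
the numbers of elements removed from `L` and from `M`. -/
theorem sum_powerset_union_eq_sum_indexPairs {L M : Finset (Fin n)} (hd : Disjoint L M) (p : ℕ)
    (f : Finset (Fin n) → W) :
    ∑ T ∈ (L ∪ M).powerset with p ≤ T.card, f T =
      ∑ ab ∈ indexPairs L M p, ∑ A ∈ removing L ab.1, ∑ B ∈ removing M ab.2,
        f (L \ A ∪ M \ B) := by
  simp_rw [← Finset.sum_product']
  rw [Finset.sum_sigma']
  have hLM : ∀ {A B : Finset (Fin n)}, Disjoint (L \ A) (M \ B) := fun {A B} =>
    Finset.disjoint_of_subset_left Finset.sdiff_subset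
      (Finset.disjoint_of_subset_right Finset.sdiff_subset hd)
  have hmem : ∀ i, i ∈ L → i ∉ M := fun i h1 h2 => Finset.disjoint_left.1 hd h1 h2
  refine Finset.sum_nbij' (fun T => ⟨((L ∩ T).card, (M ∩ T).card), (L \ T, M \ T)⟩)
    (fun x => L \ x.2.1 ∪ M \ x.2.2) (fun T hT => ?_) (fun x hx => ?_) (fun T hT => ?_)
    (fun x hx => ?_) (fun T hT => ?_)
  · rw [Finset.mem_filter, Finset.mem_powerset] at hT
    have hT' : L ∩ T ∪ M ∩ T = T := by
      rw [← Finset.union_inter_distrib_right, Finset.inter_eq_right.2 hT.1]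
    have hc := Finset.card_union_le (L ∩ T) (M ∩ T)
    rw [hT'] at hc
    refine Finset.mem_sigma.2 ⟨mem_indexPairs.2 ⟨Finset.card_le_card Finset.inter_subset_left,
      Finset.card_le_card Finset.inter_subset_left, hT.2.trans hc⟩, Finset.mem_product.2
      ⟨mem_removing.2 ⟨Finset.sdiff_subset, ?_⟩, mem_removing.2 ⟨Finset.sdiff_subset, ?_⟩⟩⟩
    · rw [Finset.sdiff_sdiff_self_left]
    · rw [Finset.sdiff_sdiff_self_left]
  · rw [Finset.mem_sigma, mem_indexPairs, Finset.mem_product, mem_removing, mem_removing] at hx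
    rw [Finset.mem_filter, Finset.mem_powerset, Finset.card_union_of_disjoint hLM, hx.2.1.2,
      hx.2.2.2]
    exact ⟨Finset.union_subset_union Finset.sdiff_subset Finset.sdiff_subset, hx.1.2.2⟩
  · rw [Finset.mem_filter, Finset.mem_powerset] at hT
    dsimp only
    rw [Finset.sdiff_sdiff_self_left, Finset.sdiff_sdiff_self_left]
    exact (Finset.union_inter_distrib_right L M T).symm.trans (Finset.inter_eq_right.2 hT.1)
  · obtain ⟨⟨a, b⟩, A, B⟩ := x
    rw [Finset.mem_sigma, mem_indexPairs, Finset.mem_product, mem_removing, mem_removing] at hx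
    obtain ⟨-, ⟨hA, ha⟩, hB, hb⟩ := hx
    dsimp only at hA ha hB hb ⊢
    have e1 : L ∩ (L \ A ∪ M \ B) = L \ A := by
      ext i; have := hmem i; simp only [Finset.mem_inter, Finset.mem_union, Finset.mem_sdiff]; tauto
    have e2 : M ∩ (L \ A ∪ M \ B) = M \ B := by
      ext i; have := hmem i; simp only [Finset.mem_inter, Finset.mem_union, Finset.mem_sdiff]; tauto
    have e3 : L \ (L \ A ∪ M \ B) = A := by
      ext i; have := hmem i; have := @hA i
      simp only [Finset.mem_union, Finset.mem_sdiff]; tauto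
    have e4 : M \ (L \ A ∪ M \ B) = B := by
      ext i; have := hmem i; have := @hB i
      simp only [Finset.mem_union, Finset.mem_sdiff]; tauto
    rw [e1, e2, e3, e4, ha, hb]
  · rw [Finset.mem_filter, Finset.mem_powerset] at hT
    dsimp only
    rw [Finset.sdiff_sdiff_self_left, Finset.sdiff_sdiff_self_left]
    exact congrArg f ((Finset.union_inter_distrib_right L M T).symm.trans
      (Finset.inter_eq_right.2 hT.1)).symm

end Reindex

/-! ### Products summed by numbers of contractions -/

namespace SymplecticBosons

variable {n : ℕ} (S : SymplecticBosons n V)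

/-- The products of `𝒳_I` and `𝒳_J`, summed over the numbers of contracted factors. -/
theorem prod_calXI_eq_sum (I J : Finset (Fin n)) {p : ℕ} (hp : 1 ≤ p) :
    prod p (S.calXI I) (S.calXI J) = ∑ ab ∈ indexPairs (I \ J) (J \ I) p,
      ∑ L' ∈ removing (I \ J) ab.1, ∑ M' ∈ removing (J \ I) ab.2,
        ((-1 : ℂ) ^ ((ab.1 : ℤ) - p) * ((ab.1 + ab.2 - 1).choose (p - 1) : ℂ)) •
          prod ((p : ℤ) - ab.1 - ab.2) (S.calXI (I ∩ J ∪ L')) (S.calXI (I ∩ J ∪ M')) := by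
  have hd : Disjoint (I \ J) (J \ I) :=
    Finset.disjoint_of_subset_right Finset.sdiff_subset Finset.sdiff_disjoint
  rw [S.prod_calXI I J hp, ← Finset.sum_filter_of_ne (p := fun T => p ≤ T.card)
    (fun T _ hT => by
      by_contra h
      exact hT (by rw [contractionCoeff, if_neg h, zero_mul, zero_smul])),
    sum_powerset_union_eq_sum_indexPairs hd]
  refine Finset.sum_congr rfl fun ab hab => Finset.sum_congr rfl fun A hA =>
    Finset.sum_congr rfl fun B hB => ?_
  obtain ⟨a, b⟩ := ab
  rw [mem_removing] at hA hB
  have hab' := (mem_indexPairs.1 hab).2.2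
  dsimp only at hA hB hab' ⊢
  have hdAB : Disjoint ((I \ J) \ A) ((J \ I) \ B) :=
    Finset.disjoint_of_subset_left Finset.sdiff_subset
      (Finset.disjoint_of_subset_right Finset.sdiff_subset hd)
  have e1 : I \ ((I \ J) \ A ∪ (J \ I) \ B) = I ∩ J ∪ A := by
    ext i; have := @hA.1 i
    simp only [Finset.mem_union, Finset.mem_sdiff, Finset.mem_inter] at this ⊢; tauto
  have e2 : J \ ((I \ J) \ A ∪ (J \ I) \ B) = I ∩ J ∪ B := by
    ext i; have := @hB.1 i
    simp only [Finset.mem_union, Finset.mem_sdiff, Finset.mem_inter] at this ⊢; tauto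
  have e3 : ∏ i ∈ (I \ J) \ A ∪ (J \ I) \ B, contr I J i = (-1) ^ b := by
    rw [Finset.prod_union hdAB, Finset.prod_eq_one fun i hi => ?_, one_mul,
      Finset.prod_congr rfl fun i hi => ?_, Finset.prod_const, hB.2]
    · simp only [Finset.mem_sdiff] at hi
      simp [contr, hi.1]
    · simp only [Finset.mem_sdiff] at hi
      simp [contr, hi.1]
  -- The exponents differ by `2b`. An integer power is needed on the right because `a - p` may be
  -- negative, while `p ≤ a + b` makes the subtraction on the left exact.
  have e4 : (-1 : ℂ) ^ (a + b - p) * (-1) ^ b = (-1) ^ ((a : ℤ) - p) := by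
    rw [← pow_add, ← zpow_natCast, show ((a + b - p + b : ℕ) : ℤ) = (a - p) + 2 * b by omega,
      zpow_add₀ (by norm_num), zpow_mul]
    norm_num
  rw [e1, e2, e3, Finset.card_union_of_disjoint hdAB, hA.2, hB.2, contractionCoeff, if_pos hab',
    mul_right_comm, e4, Nat.cast_add, sub_add_eq_sub_sub]

end SymplecticBosons

end ChiralField

end

/-! ### The main theorem -/

open ChiralField in
/-- For `n ≥ 2` symplectic bosons: the products `(𝒳_I 𝒳_J)_p` for all `p ≥ 1`, and the operator
product expansion of `𝒳_I(z) 𝒳_J(w)`, where `K = I ∩ J`, `L = I \ K` and `M = J \ K`. -/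
theorem theorem2 {n : ℕ} (hn : 2 ≤ n) {V : Type*} [AddCommGroup V] [Module ℂ V]
    (S : SymplecticBosons n V) (I J K L M : Finset (Fin n))
    (hK : K = I ∩ J) (hL : L = I \ K) (hM : M = J \ K) :
    (I ≠ J →
      (∀ p : ℕ, 1 ≤ p → p ≤ L.card + M.card →
        prod p (S.calXI I) (S.calXI J) =
          ∑ ab ∈ indexPairs L M p, ∑ L' ∈ removing L ab.1, ∑ M' ∈ removing M ab.2,
            ((-1 : ℂ) ^ ((ab.1 : ℤ) - p) * ((ab.1 + ab.2 - 1).choose (p - 1) : ℂ)) •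
              prod ((p : ℤ) - ab.1 - ab.2) (S.calXI (K ∪ L')) (S.calXI (K ∪ M'))) ∧
      (∀ p : ℕ, L.card + M.card + 1 ≤ p → prod p (S.calXI I) (S.calXI J) = 0) ∧
      OPE (S.calXI I) (S.calXI J) (L.card + M.card) fun p =>
        ∑ ab ∈ indexPairs L M p, ∑ L' ∈ removing L ab.1, ∑ M' ∈ removing M ab.2,
          ((-1 : ℂ) ^ ((ab.1 : ℤ) - p) / ((ab.1 + ab.2 - p).factorial : ℂ) *
              ((ab.1 + ab.2 - 1).choose (p - 1) : ℂ)) •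
            prod 0 (der^[ab.1 + ab.2 - p] (S.calXI (K ∪ L'))) (S.calXI (K ∪ M'))) ∧
    (I = J →
      (∀ p : ℕ, 1 ≤ p → prod p (S.calXI I) (S.calXI J) = 0) ∧
      OPE (S.calXI I) (S.calXI J) 0 fun _ => 0) := by
  have hL' : L = I \ J := by rw [hL, hK, Finset.sdiff_inter_self_left]
  have hM' : M = J \ I := by rw [hM, hK, Finset.sdiff_inter_self_right]
  have hcard : (I \ J ∪ J \ I).card = L.card + M.card := by
    rw [hL', hM', Finset.card_union_of_disjoint
      (Finset.disjoint_of_subset_right Finset.sdiff_subset Finset.sdiff_disjoint)]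
  subst hK
  clear hL hM
  subst hL' hM'
  refine ⟨fun _ => ⟨fun p hp _ => S.prod_calXI_eq_sum I J hp,
    fun p hp => S.prod_calXI_eq_zero I J (by omega), fun m k => ?_⟩, fun h => ?_⟩
  · rw [← hcard, S.OPE_calXI I J m k]
    refine Finset.sum_congr rfl fun p hp => ?_
    dsimp only
    rw [S.prod_calXI_eq_sum I J (Finset.mem_Icc.1 hp).1]
    refine congrArg (fun A : VertexOperator ℂ V =>
      ((Ring.choose m (p - 1) : ℤ) : ℂ) • A[[m + k - ((p : ℤ) - 1)]]) ?_
    refine Finset.sum_congr rfl fun ab hab => Finset.sum_congr rfl fun A _ =>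
      Finset.sum_congr rfl fun B _ => ?_
    have hab' := (mem_indexPairs.1 hab).2.2
    -- As `p ≤ a + b`, the order `p - a - b` is nonpositive, and the factorial from the iterated
    -- derivative cancels the denominator.
    rw [prod_zero_der_iterate, smul_smul,
      show (p : ℤ) - ab.1 - ab.2 = -((ab.1 + ab.2 - p : ℕ) : ℤ) by omega, mul_right_comm,
      div_mul_cancel₀ _ (Nat.cast_ne_zero.2 (Nat.factorial_ne_zero _))]
  · subst h
    have h0 : (I \ I ∪ I \ I).card = 0 := by simp
    refine ⟨fun p hp => S.prod_calXI_eq_zero I I (by omega), fun m k => ?_⟩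
    have := S.OPE_calXI I I m k
    rw [h0] at this
    simpa using this
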